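/- An ultragraph $\mathcal G=(G^0,\mathcal G^1,r,s)$ consists of countable sets $G^0$ (vertices) and $\mathcal G^1$ (edges), a map $s:\mathcal G^1\to G^0$, and a map $r$ from $\mathcal G^1$ to the nonempty subsets of $G^0$. Let $\mathcal G^0$ be the smallest collection of subsets of $G^0$ that contains $\emptyset$, all $\{v\}$ and all $r(e)$ and is closed under finite unions and intersections. A Cuntz–Krieger $\mathcal G$-family consists of partial isometries $s_e$ ($e\in\mathcal G^1$) with mutually orthogonal ranges and projections $p_A$ ($A\in\mathcal G^0$) such that $p_\emptyset=0$, $p_Ap_B=p_{A\cap B}$, $p_{A\cup B}=p_A+p_B-p_{A\cap B}$, $s_e^*s_e=p_{r(e)}$, $s_es_e^*\le p_{s(e)}$ (writing $p_v=p_{\{v\}}$), and $p_v=\sum_{s(e)=v}s_es_e^*$ whenever $0<|s^{-1}(v)|<\infty$. Let $C^*(\mathcal G)$ be the $C^*$-algebra generated by a universal Cuntz–Krieger $\mathcal G$-family. A vertex $v$ is singular if it is a sink ($s^{-1}(v)=\emptyset$) or an infinite emitter ($s^{-1}(v)$ infinite). A desingularization $\mathcal F$ of $\mathcal G$ is obtained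 by adding a tail at every singular vertex $v$: one adds new vertices $v_1,v_2,\dots$ and edges $e_i$ ($i\ge1$) with $s(e_i)=v_{i-1}$ and $r(e_i)=\{v_i\}$, where $v_0=v$; if $v$ is an infinite emitter, one also lists $s^{-1}(v)=\{g_1,g_2,\dots\}$ without repetition and replaces each $g_j$ by an edge $f_j$ with $s(f_j)=v_{j-1}$ and $r(f_j)=r(g_j)$. Then $\mathcal G^0\subseteq\mathcal F^0$. **Proposition.** Let $\mathcal G$ be an ultragraph and let $\mathcal F$ be a desingularization of $\mathcal G$, with canonical generators $\{t_e,q_A\}$ of $C^*(\mathcal F)$. Let $w_1,w_2,\dots$ and $h_1,h_2,\dots$ be (finite or infinite) lists of all elements of $G^0$ and of $\mathcal G^1$, and put $A_n=\{w_1,\dots,w_n\}\cup\bigcup_{i=1}^n r(h_i)\in\mathcal G^0$ (omitting missing entries). Then the projections $q_{A_n}$ converge strictly to a projection $p$ in the multiplier algebra $\mathcal M(C^*(\mathcal F))$, the corner $pC^*(\mathcal F)p$ is full (it is contained in no proper closed two-sided ideal of $C^*(\mathcal F)$), and $C^*(\mathcal G)\cong pC^*(\mathcal F)p$ as $C^*$-algebras.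 -/

import Mathlib

open scoped ENNReal MultiplierAlgebra Topology
open Filter

universe u

/-- An ultragraph: countable sets of vertices and edges, a source map into the vertices and a
range map into the nonempty sets of vertices. -/
structure Ultragraph where
  V : Type u
  E : Type u
  countable_V : Countable V
  countable_E : Countable E
  s : E → V
  r : E → Set V
  r_nonempty : ∀ e, (r e).Nonempty

namespace Ultragraph

/-- Membership in `𝒢⁰`, the smallest collection of sets of vertices that contains all singletons
and all ranges of edges and is closed under finite unions (including the empty one) and finite
intersections. -/
inductive IsGenSet (G : Ultragraph.{u}) : Set G.V → Prop
  | empty : IsGenSet G ∅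
  | singleton (v : G.V) : IsGenSet G {v}
  | range (e : G.E) : IsGenSet G (G.r e)
  | inter {A B : Set G.V} : IsGenSet G A → IsGenSet G B → IsGenSet G (A ∩ B)
  | union {A B : Set G.V} : IsGenSet G A → IsGenSet G B → IsGenSet G (A ∪ B)

/-- The collection `𝒢⁰`, as a type. -/
structure GenSet (G : Ultragraph.{u}) : Type u where
  set : Set G.V
  isGenSet : G.IsGenSet set

/-- The singleton `{v}` as an element of `𝒢⁰`. -/
def vert (G : Ultragraph.{u}) (v : G.V) : G.GenSet := ⟨{v}, .singleton v⟩

/-- The range `r(e)` as an element of `𝒢⁰`. -/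
def rng (G : Ultragraph.{u}) (e : G.E) : G.GenSet := ⟨G.r e, .range e⟩

/-- A Cuntz–Krieger `G`-family in a (not necessarily unital) `*`-ring. -/
structure CKFamily (G : Ultragraph.{u}) (A : Type*) [NonUnitalRing A] [StarRing A] where
  s : G.E → A
  p : G.GenSet → A
  partialIsometry : ∀ e, s e * star (s e) * s e = s e
  orthogonal_ranges : ∀ e f, e ≠ f → star (s e) * s f = 0
  projection : ∀ X, IsStarProjection (p X)
  p_empty : p ⟨∅, .empty⟩ = 0
  p_inter : ∀ X Y : G.GenSet, p X * p Y = p ⟨X.set ∩ Y.set, X.isGenSet.inter Y.isGenSet⟩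
  p_union : ∀ X Y : G.GenSet,
    p ⟨X.set ∪ Y.set, X.isGenSet.union Y.isGenSet⟩ = p X + p Y - p ⟨X.set ∩ Y.set, X.isGenSet.inter Y.isGenSet⟩
  initial : ∀ e, star (s e) * s e = p (G.rng e)
  /-- `s_e s_e^* ≤ p_{s(e)}`; for projections, `q ≤ p` means `p q = q`. -/
  final_le : ∀ e, p (G.vert (G.s e)) * (s e * star (s e)) = s e * star (s e)
  regular_sum : ∀ (v : G.V) (hfin : {e | G.s e = v}.Finite), {e | G.s e = v}.Nonempty →
    p (G.vert v) = ∑ e ∈ hfin.toFinset, s e * star (s e)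

/-! ### The universal C⋆-algebra -/

/-- A Cuntz–Krieger `G`-family of operators on some Hilbert space. -/
structure HilbertFamily (G : Ultragraph.{u}) : Type (u + 1) where
  H : Type u
  [normed : NormedAddCommGroup H]
  [inner : InnerProductSpace ℂ H]
  [complete : CompleteSpace H]
  fam : G.CKFamily (H →L[ℂ] H)

attribute [instance] HilbertFamily.normed HilbertFamily.inner HilbertFamily.complete

/-- The bounded elements of the product of the algebras `B(H)`, over all Cuntz–Krieger
`G`-families on Hilbert spaces `H`, with the supremum norm. -/
def Ambient (G : Ultragraph.{u}) : Type (u + 1) :=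
  lp (fun ω : G.HilbertFamily => ω.H →L[ℂ] ω.H) ∞

noncomputable instance (G : Ultragraph.{u}) : NonUnitalCStarAlgebra G.Ambient :=
  inferInstanceAs (NonUnitalCStarAlgebra (lp (fun ω : G.HilbertFamily => ω.H →L[ℂ] ω.H) ∞))

/-- The coordinate of the product at a family `ω`. -/
noncomputable def coord (G : Ultragraph.{u}) (ω : G.HilbertFamily) :
    G.Ambient →⋆ₙₐ[ℂ] (ω.H →L[ℂ] ω.H) where
  toFun a := a.1 ω
  map_smul' _ _ := rfl
  map_zero' := rfl
  map_add' _ _ := rfl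
  map_mul' _ _ := rfl
  map_star' _ := rfl

theorem norm_le_one_of_partialIsometry {A : Type*} [NonUnitalCStarAlgebra A] {x : A}
    (hx : x * star x * x = x) : ‖x‖ ≤ 1 := by
  have h1 : IsStarProjection (star x * x) := by
    refine ⟨?_, ?_⟩
    · change star x * x * (star x * x) = star x * x
      calc star x * x * (star x * x) = star x * (x * star x * x) := by simp only [mul_assoc]
        _ = _ := by rw [hx]
    · exact IsSelfAdjoint.star_mul_self x
  have h2 : ‖star x * x‖ * ‖star x * x‖ = ‖star x * x‖ := by
    rw [← CStarRing.norm_star_mul_self (x := star x * x), h1.isSelfAdjoint.star_eq,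
      h1.isIdempotentElem.eq]
  have h3 := CStarRing.norm_star_mul_self (x := x)
  have h0 := norm_nonneg x
  by_contra! h
  have : 1 < ‖star x * x‖ := by rw [h3]; nlinarith
  nlinarith

theorem CKFamily.norm_s_le {G : Ultragraph.{u}} {A : Type*} [NonUnitalCStarAlgebra A]
    (F : G.CKFamily A) (e : G.E) : ‖F.s e‖ ≤ 1 :=
  norm_le_one_of_partialIsometry (F.partialIsometry e)

theorem CKFamily.norm_p_le {G : Ultragraph.{u}} {A : Type*} [NonUnitalCStarAlgebra A]
    (F : G.CKFamily A) (X : G.GenSet) : ‖F.p X‖ ≤ 1 :=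
  norm_le_one_of_partialIsometry (by
    rw [(F.projection X).isSelfAdjoint.star_eq, (F.projection X).isIdempotentElem.eq,
      (F.projection X).isIdempotentElem.eq])

/-- The element `(S_e)_ω` of the product, where `ω = (S, P)` runs over all families. -/
noncomputable def ambS (G : Ultragraph.{u}) (e : G.E) : G.Ambient :=
  ⟨fun ω => ω.fam.s e, memℓp_infty ⟨1, by rintro _ ⟨ω, rfl⟩; exact ω.fam.norm_s_le e⟩⟩

/-- The element `(P_X)_ω` of the product, where `ω = (S, P)` runs over all families. -/
noncomputable def ambP (G : Ultragraph.{u}) (X : G.GenSet) : G.Ambient :=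
  ⟨fun ω => ω.fam.p X, memℓp_infty ⟨1, by rintro _ ⟨ω, rfl⟩; exact ω.fam.norm_p_le X⟩⟩

/-- The C⋆-subalgebra of the product generated by the elements `ambS e` and `ambP X`. -/
noncomputable def cstarSub (G : Ultragraph.{u}) : NonUnitalStarSubalgebra ℂ G.Ambient :=
  (NonUnitalStarAlgebra.adjoin ℂ (Set.range G.ambS ∪ Set.range G.ambP)).topologicalClosure

/-- `C*(G)`, the C⋆-algebra generated by a universal Cuntz–Krieger `G`-family: the completion of
the `*`-algebra generated by the symbols `s_e`, `p_X` with respect to the norm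
`‖a‖ = sup ‖π(a)‖` over all its representations `π` by Cuntz–Krieger families on Hilbert spaces,
realised in the product of all these representations. -/
def CStar (G : Ultragraph.{u}) : Type (u + 1) := G.cstarSub

noncomputable instance (G : Ultragraph.{u}) : NonUnitalCStarAlgebra G.CStar :=
  NonUnitalStarSubalgebra.nonUnitalCStarAlgebra G.cstarSub
    (h_closed := NonUnitalStarSubalgebra.isClosed_topologicalClosure _)

theorem ambS_mem (G : Ultragraph.{u}) (e : G.E) : G.ambS e ∈ G.cstarSub :=
  NonUnitalStarSubalgebra.le_topologicalClosure _
    (NonUnitalStarAlgebra.subset_adjoin ℂ _ (.inl ⟨e, rfl⟩))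

theorem ambP_mem (G : Ultragraph.{u}) (X : G.GenSet) : G.ambP X ∈ G.cstarSub :=
  NonUnitalStarSubalgebra.le_topologicalClosure _
    (NonUnitalStarAlgebra.subset_adjoin ℂ _ (.inr ⟨X, rfl⟩))

/-- The inclusion of `C*(G)` into the product. -/
noncomputable def incl (G : Ultragraph.{u}) : G.CStar →⋆ₙₐ[ℂ] G.Ambient :=
  NonUnitalStarSubalgebraClass.subtype G.cstarSub

/-- The coordinate at a family `ω`, as a `*`-homomorphism from `C*(G)` to `B(H)`. -/
noncomputable def rep (G : Ultragraph.{u}) (ω : G.HilbertFamily) :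
    G.CStar →⋆ₙₐ[ℂ] (ω.H →L[ℂ] ω.H) :=
  (G.coord ω).comp G.incl

theorem CStar.ext_rep {G : Ultragraph.{u}} {a b : G.CStar} (h : ∀ ω, G.rep ω a = G.rep ω b) :
    a = b :=
  Subtype.ext (lp.ext (funext h))

/-- The canonical generator `s_e` of `C*(G)`. -/
noncomputable def genS (G : Ultragraph.{u}) (e : G.E) : G.CStar := ⟨G.ambS e, G.ambS_mem e⟩

/-- The canonical generator `p_X` of `C*(G)`. -/
noncomputable def genP (G : Ultragraph.{u}) (X : G.GenSet) : G.CStar := ⟨G.ambP X, G.ambP_mem X⟩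

theorem rep_genS (G : Ultragraph.{u}) (ω : G.HilbertFamily) (e : G.E) :
    G.rep ω (G.genS e) = ω.fam.s e := rfl

theorem rep_genP (G : Ultragraph.{u}) (ω : G.HilbertFamily) (X : G.GenSet) :
    G.rep ω (G.genP X) = ω.fam.p X := rfl

/-- The canonical Cuntz–Krieger `G`-family in `C*(G)`. -/
noncomputable def gen (G : Ultragraph.{u}) : G.CKFamily G.CStar where
  s := G.genS
  p := G.genP
  partialIsometry e := CStar.ext_rep fun ω => by
    simpa only [map_mul, map_star, rep_genS] using ω.fam.partialIsometry e
  orthogonal_ranges e f h := CStar.ext_rep fun ω => by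
    simpa only [map_mul, map_star, rep_genS, map_zero] using ω.fam.orthogonal_ranges e f h
  projection X := ⟨CStar.ext_rep fun ω => by
      simpa only [map_mul, rep_genP] using (ω.fam.projection X).isIdempotentElem.eq,
    CStar.ext_rep fun ω => by
      simpa only [map_star, rep_genP] using (ω.fam.projection X).isSelfAdjoint.star_eq⟩
  p_empty := CStar.ext_rep fun ω => by
    simpa only [rep_genP, map_zero] using ω.fam.p_empty
  p_inter X Y := CStar.ext_rep fun ω => by
    simpa only [map_mul, rep_genP] using ω.fam.p_inter X Y
  p_union X Y := CStar.ext_rep fun ω => by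
    simpa only [map_add, map_sub, rep_genP] using ω.fam.p_union X Y
  initial e := CStar.ext_rep fun ω => by
    simpa only [map_mul, map_star, rep_genS, rep_genP] using ω.fam.initial e
  final_le e := CStar.ext_rep fun ω => by
    simpa only [map_mul, map_star, rep_genS, rep_genP] using ω.fam.final_le e
  regular_sum v hfin hne := CStar.ext_rep fun ω => by
    simpa only [map_sum, map_mul, map_star, rep_genS, rep_genP] using
      ω.fam.regular_sum v hfin hne

/-- `C*(G)` is generated by the canonical family: a closed `*`-subalgebra that contains all the
generators is everything. -/
theorem eq_top_of_gen_mem (G : Ultragraph.{u}) (S : NonUnitalStarSubalgebra ℂ G.CStar)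
    (hS : IsClosed (S : Set G.CStar)) (hs : ∀ e, G.gen.s e ∈ S) (hp : ∀ X, G.gen.p X ∈ S) :
    S = ⊤ := by
  have hemb : Topology.IsClosedEmbedding G.incl :=
    (NonUnitalStarSubalgebra.isClosed_topologicalClosure _).isClosedEmbedding_subtypeVal
  have hcl : IsClosed ((S.map G.incl : NonUnitalStarSubalgebra ℂ G.Ambient) : Set G.Ambient) :=
    hemb.isClosedMap _ hS
  have hle : G.cstarSub ≤ S.map G.incl := by
    refine NonUnitalStarSubalgebra.topologicalClosure_minimal _ ?_ hcl
    refine NonUnitalStarAlgebra.adjoin_le ?_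
    rintro _ (⟨e, rfl⟩ | ⟨X, rfl⟩)
    · exact ⟨G.gen.s e, hs e, rfl⟩
    · exact ⟨G.gen.p X, hp X, rfl⟩
  refine eq_top_iff.2 fun a _ => ?_
  obtain ⟨b, hb, hba⟩ := hle a.2
  have : b = a := hemb.injective hba
  exact this ▸ hb

/-- Every Cuntz–Krieger `G`-family on a Hilbert space is the image of the canonical one under a
unique `*`-homomorphism. -/
theorem existsUnique_rep (G : Ultragraph.{u}) (ω : G.HilbertFamily) :
    ∃! φ : G.CStar →⋆ₙₐ[ℂ] (ω.H →L[ℂ] ω.H),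
      (∀ e, φ (G.gen.s e) = ω.fam.s e) ∧ ∀ X, φ (G.gen.p X) = ω.fam.p X := by
  refine ⟨G.rep ω, ⟨fun _ => rfl, fun _ => rfl⟩, ?_⟩
  rintro ψ ⟨hs, hp⟩
  have hc : ∀ φ : G.CStar →⋆ₙₐ[ℂ] (ω.H →L[ℂ] ω.H), Continuous φ := fun φ =>
    AddMonoidHomClass.continuous_of_bound φ 1 fun a => by
      simpa only [one_mul] using NonUnitalStarAlgHom.norm_apply_le φ a
  have := G.eq_top_of_gen_mem (NonUnitalStarAlgHom.equalizer ψ (G.rep ω))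
    (isClosed_eq (hc _) (hc _)) hs hp
  ext1 a
  have ha : a ∈ NonUnitalStarAlgHom.equalizer ψ (G.rep ω) := this ▸ trivial
  exact ha

/-! ### Corners -/

section Corner

variable {A : Type*} [NonUnitalCStarAlgebra A]

/-- Strict convergence in the multiplier algebra: `x n a → p a` and `a x n → a p` in norm, for
all `a` in `A`. -/
def StrictlyTendsto (x : ℕ → 𝓜(ℂ, A)) (p : 𝓜(ℂ, A)) : Prop :=
  ∀ a : A, Tendsto (fun n => (x n).fst a) atTop (𝓝 (p.fst a)) ∧
    Tendsto (fun n => (x n).snd a) atTop (𝓝 (p.snd a))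

theorem eq_of_forall_mul_eq {x y : A} (h : ∀ z, z * x = z * y) : x = y := by
  have h1 : star (x - y) * (x - y) = 0 := by rw [mul_sub, h, sub_self]
  exact sub_eq_zero.1 ((CStarRing.star_mul_self_eq_zero_iff _).1 h1)

theorem eq_of_forall_eq_mul {x y : A} (h : ∀ z, x * z = y * z) : x = y := by
  have h1 : (x - y) * star (x - y) = 0 := by rw [sub_mul, h, sub_self]
  exact sub_eq_zero.1 ((CStarRing.mul_star_self_eq_zero_iff _).1 h1)

theorem fst_mul (p : 𝓜(ℂ, A)) (x y : A) : p.fst (x * y) = p.fst x * y :=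
  eq_of_forall_mul_eq fun z => by
    rw [← p.central, ← mul_assoc, p.central, mul_assoc]

theorem snd_mul (p : 𝓜(ℂ, A)) (x y : A) : p.snd (x * y) = x * p.snd y :=
  eq_of_forall_eq_mul fun z => by
    rw [p.central, mul_assoc, mul_assoc, p.central]

theorem fst_snd_comm (p : 𝓜(ℂ, A)) (b : A) : p.fst (p.snd b) = p.snd (p.fst b) :=
  eq_of_forall_mul_eq fun z => by
    rw [← p.central, ← snd_mul, p.central, snd_mul]

/-- The corner `pAp` of `A`, for a projection `p` in the multiplier algebra of `A`. Here
`p.fst` and `p.snd` are left and right multiplication by `p`. -/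
def corner (p : 𝓜(ℂ, A)) (hp : IsStarProjection p) : NonUnitalStarSubalgebra ℂ A where
  carrier := Set.range fun b : A => p.fst (p.snd b)
  add_mem' := by
    rintro _ _ ⟨a, rfl⟩ ⟨b, rfl⟩
    exact ⟨a + b, by simp only [map_add]⟩
  zero_mem' := ⟨0, by simp only [map_zero]⟩
  mul_mem' := by
    rintro _ _ ⟨a, rfl⟩ ⟨b, rfl⟩
    have hf : ∀ x, p.fst (p.fst x) = p.fst x := fun x =>
      DFunLike.congr_fun (congrArg (fun q : 𝓜(ℂ, A) => q.fst) hp.isIdempotentElem.eq) x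
    have hs : ∀ x, p.snd (p.snd x) = p.snd x := fun x =>
      DFunLike.congr_fun (congrArg (fun q : 𝓜(ℂ, A) => q.snd) hp.isIdempotentElem.eq) x
    refine ⟨p.fst (p.snd a) * p.fst (p.snd b), ?_⟩
    simp only
    rw [snd_mul, fst_mul, hf, ← fst_snd_comm p (p.snd b), hs]
  smul_mem' := by
    rintro c _ ⟨a, rfl⟩
    exact ⟨c • a, by simp only [map_smul]⟩
  star_mem' := by
    rintro _ ⟨a, rfl⟩
    have hstar : ∀ x, p.fst (star x) = star (p.snd x) := fun x => by
      have h := DoubleCentralizer.star_fst p (star x)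
      rwa [hp.isSelfAdjoint.star_eq, star_star] at h
    have hstar' : ∀ x, p.snd (star x) = star (p.fst x) := fun x => by
      have h := DoubleCentralizer.star_snd p (star x)
      rwa [hp.isSelfAdjoint.star_eq, star_star] at h
    refine ⟨star a, ?_⟩
    simp only
    rw [hstar', hstar, fst_snd_comm]

/-- The corner `pAp` is full: no proper closed two-sided ideal of `A` contains it. -/
def IsFullCorner (p : 𝓜(ℂ, A)) (hp : IsStarProjection p) : Prop :=
  ∀ J : TwoSidedIdeal A, IsClosed (J : Set A) → (corner p hp : Set A) ⊆ J → J = ⊤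

end Corner

/-! ### Desingularizations -/

def IsSink (G : Ultragraph.{u}) (v : G.V) : Prop := {e | G.s e = v} = ∅

def IsInfiniteEmitter (G : Ultragraph.{u}) (v : G.V) : Prop := {e | G.s e = v}.Infinite

def IsSingular (G : Ultragraph.{u}) (v : G.V) : Prop := G.IsSink v ∨ G.IsInfiniteEmitter v

/-- For each infinite emitter `v`, a listing `g_1, g_2, …` of `s⁻¹(v)` without repetition
(`g_{n+1}` has index `n`). -/
abbrev EmitterListing (G : Ultragraph.{u}) : Type u :=
  ∀ v : {v : G.V // G.IsInfiniteEmitter v}, ℕ ≃ {e : G.E // G.s e = v.1}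

/-- The vertices `v = v_0, v_1, v_2, …` of the tail added at the singular vertex `v`. -/
def tailVertex {G : Ultragraph.{u}} (v : {v : G.V // G.IsSingular v}) :
    ℕ → G.V ⊕ ({v : G.V // G.IsSingular v} × ℕ)
  | 0 => .inl v.1
  | n + 1 => .inr (v, n)

/-- The desingularization of `G` obtained by adding a tail at every singular vertex, with the
given listings of the edges that leave the infinite emitters. Its edges are
* the edges of `G` whose source is not an infinite emitter;
* for every singular vertex `v` the tail edges `e_{n+1}` (index `n`), from `v_n` to `v_{n+1}`;
* for every infinite emitter `v` the edges `f_{n+1}` (index `n`), with source `v_n` and with the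
  range of `g_{n+1}`, which replace the edges `g_{n+1}`. -/
def desingularization (G : Ultragraph.{u}) (g : G.EmitterListing) : Ultragraph.{u} where
  V := G.V ⊕ ({v : G.V // G.IsSingular v} × ℕ)
  E := {e : G.E // ¬ G.IsInfiniteEmitter (G.s e)} ⊕
    (({v : G.V // G.IsSingular v} × ℕ) ⊕ ({v : G.V // G.IsInfiniteEmitter v} × ℕ))
  countable_V := by
    have := G.countable_V
    infer_instance
  countable_E := by
    have := G.countable_V
    have := G.countable_E
    infer_instance
  s
    | .inl e => .inl (G.s e.1)
    | .inr (.inl (v, n)) => tailVertex v n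
    | .inr (.inr (v, n)) => tailVertex ⟨v.1, .inr v.2⟩ n
  r
    | .inl e => Sum.inl '' G.r e.1
    | .inr (.inl (v, n)) => {tailVertex v (n + 1)}
    | .inr (.inr (v, n)) => Sum.inl '' G.r (g v n).1
  r_nonempty
    | .inl e => (G.r_nonempty e.1).image _
    | .inr (.inl (_, _)) => Set.singleton_nonempty _
    | .inr (.inr (v, n)) => (G.r_nonempty (g v n).1).image _

/-- The inclusion of the vertices of `G` into those of the desingularization. -/
def inclV (G : Ultragraph.{u}) (g : G.EmitterListing) : G.V → (G.desingularization g).V := Sum.inl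

theorem isGenSet_image (G : Ultragraph.{u}) (g : G.EmitterListing) {X : Set G.V}
    (hX : G.IsGenSet X) : (G.desingularization g).IsGenSet (G.inclV g '' X) := by
  induction hX with
  | empty => rw [Set.image_empty]; exact .empty
  | singleton v => rw [Set.image_singleton]; exact .singleton _
  | range e =>
    by_cases h : G.IsInfiniteEmitter (G.s e)
    · have := IsGenSet.range (G := G.desingularization g)
        (.inr (.inr (⟨G.s e, h⟩, (g ⟨G.s e, h⟩).symm ⟨e, rfl⟩)))
      have h2 : (G.desingularization g).r
          (.inr (.inr (⟨G.s e, h⟩, (g ⟨G.s e, h⟩).symm ⟨e, rfl⟩))) = G.inclV g '' G.r e := by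
        change Sum.inl '' G.r (g ⟨G.s e, h⟩ ((g ⟨G.s e, h⟩).symm ⟨e, rfl⟩)).1 = _
        rw [Equiv.apply_symm_apply]
        rfl
      exact h2 ▸ this
    · exact IsGenSet.range (G := G.desingularization g) (.inl ⟨e, h⟩)
  | inter _ _ ihA ihB =>
    have hinj : Function.Injective (G.inclV g) := Sum.inl_injective
    rw [Set.image_inter hinj]
    exact ihA.inter ihB
  | union _ _ ihA ihB => rw [Set.image_union]; exact ihA.union ihB

/-- A set in `𝒢⁰`, regarded as a set of vertices of the desingularization. -/
def GenSet.toDesing {G : Ultragraph.{u}} (g : G.EmitterListing) (X : G.GenSet) :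
    (G.desingularization g).GenSet :=
  ⟨G.inclV g '' X.set, G.isGenSet_image g X.isGenSet⟩

/-- The underlying set of `A_n = {w_1, …, w_n} ∪ r(h_1) ∪ … ∪ r(h_n)`. -/
def initialSet (G : Ultragraph.{u}) (w : ℕ → Option G.V) (h : ℕ → Option G.E) (n : ℕ) :
    Set G.V :=
  {v | ∃ i < n, w i = some v} ∪ {v | ∃ i < n, ∃ e, h i = some e ∧ v ∈ G.r e}

theorem isGenSet_initialSet (G : Ultragraph.{u}) (w : ℕ → Option G.V) (h : ℕ → Option G.E)
    (n : ℕ) : G.IsGenSet (G.initialSet w h n) := by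
  induction n with
  | zero =>
    have : G.initialSet w h 0 = ∅ := by simp [initialSet]
    rw [this]
    exact .empty
  | succ n ih =>
    have h1 : G.IsGenSet {v | w n = some v} := by
      cases hw : w n with
      | none => simpa using IsGenSet.empty
      | some v => simpa [Set.ofPred_eq_eq_singleton'] using IsGenSet.singleton v
    have h2 : G.IsGenSet {v | ∃ e, h n = some e ∧ v ∈ G.r e} := by
      cases hh : h n with
      | none => simpa using IsGenSet.empty
      | some e => simpa using IsGenSet.range e
    have : G.initialSet w h (n + 1) =
        G.initialSet w h n ∪ ({v | w n = some v} ∪ {v | ∃ e, h n = some e ∧ v ∈ G.r e}) := by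
      ext v
      simp only [initialSet, Set.mem_union, Set.mem_ofPred_eq, Nat.exists_lt_succ_right]
      grind
    rw [this]
    exact ih.union (h1.union h2)

/-- The set `A_n = {w_1, …, w_n} ∪ r(h_1) ∪ … ∪ r(h_n)` for a list `w_1, w_2, …` of vertices and
a list `h_1, h_2, …` of edges. The `i`-th entries have index `i - 1`; the value `none` stands for
a missing entry, so that finite lists are allowed. -/
def initialGenSet (G : Ultragraph.{u}) (w : ℕ → Option G.V) (h : ℕ → Option G.E) (n : ℕ) :
    G.GenSet :=
  ⟨G.initialSet w h n, G.isGenSet_initialSet w h n⟩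

end Ultragraph

/-!
A Cuntz–Krieger family of the desingularization `F` restricts to one of `G`: an edge `g_{n+1}`
leaving an infinite emitter is sent to the path `e_1 ⋯ e_n f_{n+1}` through its tail. This gives a
homomorphism `φ : C*(G) → C*(F)`.

It is injective because every family of `G` on a Hilbert space is the restriction of its dilation,
in which the vertex `v_n` of a tail carries, in a Hilbert space summand of its own, the remainder
`p_v - ∑_{j ≤ n} s_{g_j} s_{g_j}^*`.

Its range is `p C*(F) p` because every vertex of `F` is connected to one of `G` by a tail path:
with `T` the path from `v` to `v_n`, `T T^*` is the remainder in the range of `φ` and `T^* T` is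
the projection at `v_n`. The projections at sets of vertices of `G` and the tail paths thus form a
column that compresses each generator of `C*(F)`, and then each element of it, into the range.
The same connections make the corner full, and the strict limit exists because `q_{A_n}` times a
vertex projection is eventually constant.
-/

namespace Ultragraph

/-! ### Strict limits and corners -/

section StrictLimit

theorem tendsto_apply_of_tendsto_pointwise {E F : Type*} [NormedAddCommGroup E]
    [NormedSpace ℂ E] [CompleteSpace E] [NormedAddCommGroup F] [NormedSpace ℂ F]
    {T : ℕ → E →L[ℂ] F} {S : E →L[ℂ] F} (hT : ∀ x, Tendsto (fun n => T n x) atTop (𝓝 (S x)))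
    {y : ℕ → E} {y₀ : E} (hy : Tendsto y atTop (𝓝 y₀)) :
    Tendsto (fun n => T n (y n)) atTop (𝓝 (S y₀)) := by
  obtain ⟨C, hC⟩ := banach_steinhaus (g := T) fun x => by
    obtain ⟨C, hC⟩ := (hT x).norm.bddAbove_range
    exact ⟨C, fun n => hC ⟨n, rfl⟩⟩
  have hdiff : Tendsto (fun n => T n (y n - y₀)) atTop (𝓝 0) :=
    squeeze_zero_norm (fun n => (T n).le_of_opNorm_le (hC n) _) <| by
      simpa only [sub_self, norm_zero, mul_zero] using (hy.sub_const y₀).norm.const_mul C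
  simpa only [map_sub, sub_add_cancel, zero_add] using hdiff.add (hT y₀)

theorem isClosed_setOf_cauchySeq {α β : Type*} [PseudoMetricSpace α] [PseudoMetricSpace β]
    {f : ℕ → α → β} (hf : UniformEquicontinuous f) :
    IsClosed {a | CauchySeq fun n => f n a} := by
  refine isClosed_of_closure_subset fun a ha => Metric.cauchySeq_iff'.2 fun ε hε => ?_
  obtain ⟨δ, hδ, hdist⟩ := Metric.uniformEquicontinuous_iff.1 hf (ε / 3) (by positivity)
  obtain ⟨b, hb, hab⟩ := Metric.mem_closure_iff.1 ha δ hδ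
  obtain ⟨N, hN⟩ := Metric.cauchySeq_iff'.1 hb (ε / 3) (by positivity)
  refine ⟨N, fun n hn => ?_⟩
  calc dist (f n a) (f N a)
      ≤ dist (f n a) (f n b) + dist (f n b) (f N b) + dist (f N b) (f N a) :=
        dist_triangle4 _ _ _ _
    _ < ε / 3 + ε / 3 + ε / 3 := by
        gcongr
        · exact hdist a b hab n
        · exact hN n hn
        · exact hdist b a (dist_comm a b ▸ hab) N
    _ = ε := by ring

variable {A : Type*} [NonUnitalCStarAlgebra A]

theorem exists_strictlyTendsto {x : ℕ → 𝓜(ℂ, A)}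
    (hl : ∀ a, ∃ l, Tendsto (fun n => (x n).fst a) atTop (𝓝 l))
    (hr : ∀ a, ∃ r, Tendsto (fun n => (x n).snd a) atTop (𝓝 r)) :
    ∃ p, StrictlyTendsto x p := by
  choose l hl using hl
  choose r hr using hr
  refine ⟨⟨(continuousLinearMapOfTendsto (fun n => (x n).fst) (tendsto_pi_nhds.2 hl),
    continuousLinearMapOfTendsto (fun n => (x n).snd) (tendsto_pi_nhds.2 hr)), fun a b => ?_⟩,
    fun a => ⟨hl a, hr a⟩⟩
  refine tendsto_nhds_unique ((hr a).mul_const b) ?_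
  simp only [(x _).central]
  exact (hl b).const_mul a

namespace StrictlyTendsto

variable {x y : ℕ → 𝓜(ℂ, A)} {p p' : 𝓜(ℂ, A)}

theorem unique (hp : StrictlyTendsto x p) (hp' : StrictlyTendsto x p') : p = p' :=
  DoubleCentralizer.ext ℂ A p p' <| Prod.ext
    (ContinuousLinearMap.ext fun a => tendsto_nhds_unique (hp a).1 (hp' a).1)
    (ContinuousLinearMap.ext fun a => tendsto_nhds_unique (hp a).2 (hp' a).2)

theorem star (h : StrictlyTendsto x p) : StrictlyTendsto (fun n => star (x n)) (star p) :=
  fun a => by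
    simp only [DoubleCentralizer.star_fst, DoubleCentralizer.star_snd]
    exact ⟨(h _).2.star, (h _).1.star⟩

theorem mul (hx : StrictlyTendsto x p) (hy : StrictlyTendsto y p') :
    StrictlyTendsto (fun n => x n * y n) (p * p') := fun a =>
  ⟨tendsto_apply_of_tendsto_pointwise (fun a => (hx a).1) (hy a).1,
    tendsto_apply_of_tendsto_pointwise (fun a => (hy a).2) (hx a).2⟩

theorem isStarProjection (h : StrictlyTendsto x p) (hx : ∀ n, IsStarProjection (x n)) :
    IsStarProjection p where
  isIdempotentElem := (h.mul h).unique (by simpa only [(hx _).isIdempotentElem.eq] using h)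
  isSelfAdjoint := h.star.unique (by simpa only [(hx _).isSelfAdjoint.star_eq] using h)

theorem tendsto_fst_snd (h : StrictlyTendsto x p) (a : A) :
    Tendsto (fun n => (x n).fst ((x n).snd a)) atTop (𝓝 (p.fst (p.snd a))) :=
  tendsto_apply_of_tendsto_pointwise (fun a => (h a).1) (h a).2

end StrictlyTendsto

section Corner

variable {p : 𝓜(ℂ, A)} (hp : IsStarProjection p)
include hp

theorem mem_corner_iff {a : A} : a ∈ corner p hp ↔ p.fst a = a ∧ p.snd a = a := by
  have hfst : ∀ b, p.fst (p.fst b) = p.fst b := fun b => by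
    rw [← mul_apply_eq_comp, ← DoubleCentralizer.mul_fst, hp.isIdempotentElem.eq]
  have hsnd : ∀ b, p.snd (p.snd b) = p.snd b := fun b => by
    rw [← mul_apply_eq_comp, ← DoubleCentralizer.mul_snd, hp.isIdempotentElem.eq]
  refine ⟨?_, fun ⟨hl, hr⟩ => ⟨a, by simp only [hr, hl]⟩⟩
  rintro ⟨b, rfl⟩
  exact ⟨hfst _, by rw [← fst_snd_comm, hsnd]⟩

theorem isClosed_corner : IsClosed (corner p hp : Set A) := by
  have : (corner p hp : Set A) = {a | p.fst a = a} ∩ {a | p.snd a = a} :=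
    Set.ext fun a => mem_corner_iff hp
  rw [this]
  exact (isClosed_eq p.fst.continuous continuous_id).inter
    (isClosed_eq p.snd.continuous continuous_id)

theorem mul_mul_mem_corner {a b : A} (ha : a ∈ corner p hp) (x : A) (hb : b ∈ corner p hp) :
    a * x * b ∈ corner p hp := by
  rw [mem_corner_iff] at ha hb ⊢
  rw [mul_assoc, fst_mul, ha.1, ← mul_assoc, snd_mul, hb.2]
  exact ⟨rfl, rfl⟩

theorem StrictlyTendsto.mem_corner {x : ℕ → 𝓜(ℂ, A)} (h : StrictlyTendsto x p) {a : A}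
    (ha : ∀ᶠ n in atTop, (x n).fst a = a ∧ (x n).snd a = a) : a ∈ corner p hp :=
  (mem_corner_iff hp).2
    ⟨tendsto_nhds_unique (h a).1 (tendsto_const_nhds.congr' (ha.mono fun _ h => h.1.symm)),
      tendsto_nhds_unique (h a).2 (tendsto_const_nhds.congr' (ha.mono fun _ h => h.2.symm))⟩

end Corner

end StrictLimit

/-! ### Cuntz–Krieger families -/

theorem GenSet.ext {G : Ultragraph.{u}} {X Y : G.GenSet} (h : X.set = Y.set) : X = Y := by
  cases X; cases Y; cases h; rfl

theorem GenSet.induction {G : Ultragraph.{u}} {P : G.GenSet → Prop} (empty : P ⟨∅, .empty⟩)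
    (vert : ∀ v, P (G.vert v)) (rng : ∀ e, P (G.rng e))
    (inter : ∀ X Y : G.GenSet, P X → P Y → P ⟨X.set ∩ Y.set, X.isGenSet.inter Y.isGenSet⟩)
    (union : ∀ X Y : G.GenSet, P X → P Y → P ⟨X.set ∪ Y.set, X.isGenSet.union Y.isGenSet⟩)
    (X : G.GenSet) : P X := by
  obtain ⟨X, hX⟩ := X
  induction hX with
  | empty => exact empty
  | singleton v => exact vert v
  | range e => exact rng e
  | inter hA hB ihA ihB => exact inter ⟨_, hA⟩ ⟨_, hB⟩ ihA ihB
  | union hA hB ihA ihB => exact union ⟨_, hA⟩ ⟨_, hB⟩ ihA ihB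

namespace CKFamily

section Ring

variable {G : Ultragraph.{u}} {A : Type*} [NonUnitalRing A] [StarRing A] (F : G.CKFamily A)

theorem star_p (X : G.GenSet) : star (F.p X) = F.p X := (F.projection X).isSelfAdjoint.star_eq

theorem p_mul_self (X : G.GenSet) : F.p X * F.p X = F.p X := (F.projection X).isIdempotentElem.eq

theorem p_mul_of_subset {X Y : G.GenSet} (h : X.set ⊆ Y.set) : F.p X * F.p Y = F.p X := by
  rw [F.p_inter]
  exact congrArg F.p (GenSet.ext (Set.inter_eq_left.2 h))

theorem p_mul_of_superset {X Y : G.GenSet} (h : Y.set ⊆ X.set) : F.p X * F.p Y = F.p Y := by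
  rw [F.p_inter]
  exact congrArg F.p (GenSet.ext (Set.inter_eq_right.2 h))

theorem p_mul_of_disjoint {X Y : G.GenSet} (h : Disjoint X.set Y.set) : F.p X * F.p Y = 0 := by
  rw [F.p_inter, ← F.p_empty]
  exact congrArg F.p (GenSet.ext h.inter_eq)

theorem p_vert_mul_s (e : G.E) : F.p (G.vert (G.s e)) * F.s e = F.s e := by
  conv_lhs => rw [← F.partialIsometry e, ← mul_assoc, F.final_le, F.partialIsometry]

theorem s_mul_p_rng (e : G.E) : F.s e * F.p (G.rng e) = F.s e := by
  rw [← F.initial, ← mul_assoc, F.partialIsometry]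

theorem p_rng_mul_star_s (e : G.E) : F.p (G.rng e) * star (F.s e) = star (F.s e) := by
  rw [← F.star_p, ← star_mul, F.s_mul_p_rng]

theorem p_mul_s_of_mem {X : G.GenSet} {e : G.E} (h : G.s e ∈ X.set) : F.p X * F.s e = F.s e := by
  rw [← F.p_vert_mul_s, ← mul_assoc, F.p_mul_of_superset (Set.singleton_subset_iff.2 h)]

theorem p_mem_of_vert_mem_of_rng_mem {R : AddSubgroup A} (hmul : ∀ a ∈ R, ∀ b, a * b ∈ R)
    (hvert : ∀ v, F.p (G.vert v) ∈ R) (hrng : ∀ e, F.p (G.rng e) ∈ R) (X : G.GenSet) :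
    F.p X ∈ R := by
  induction X using GenSet.induction with
  | empty => exact F.p_empty ▸ R.zero_mem
  | vert v => exact hvert v
  | rng e => exact hrng e
  | inter X Y hX _ => exact F.p_inter X Y ▸ hmul _ hX _
  | union X Y hX hY =>
    rw [F.p_union, ← F.p_inter]
    exact R.sub_mem (R.add_mem hX hY) (hmul _ hX _)

/-- The image of a Cuntz–Krieger family under a `*`-homomorphism. -/
@[simps s]
def map {B : Type*} [NonUnitalRing B] [StarRing B] [Module ℂ A] [Module ℂ B] (F : G.CKFamily A)
    (φ : A →⋆ₙₐ[ℂ] B) : G.CKFamily B where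
  s e := φ (F.s e)
  p X := φ (F.p X)
  partialIsometry e := by simp only [← map_star, ← map_mul, F.partialIsometry]
  orthogonal_ranges e f h := by
    simp only [← map_star, ← map_mul, F.orthogonal_ranges e f h, map_zero]
  projection X := (F.projection X).map φ
  p_empty := by rw [F.p_empty, map_zero]
  p_inter X Y := by rw [← map_mul, F.p_inter]
  p_union X Y := by rw [F.p_union, map_sub, map_add]
  initial e := by rw [← map_star, ← map_mul, F.initial]
  final_le e := by simp only [← map_star, ← map_mul, F.final_le]
  regular_sum v hfin hne := by
    simp only [F.regular_sum v hfin hne, map_sum, map_mul, map_star]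

end Ring

end CKFamily

/-! ### The universal property and closed right ideals -/

/-- The Hilbert space representation of `C*(G)` given by a Cuntz–Krieger `G`-family in `C*(G')`
and a Hilbert space representation of `C*(G')`. -/
noncomputable def CKFamily.pullback {G G' : Ultragraph.{u}} (F : G.CKFamily G'.CStar)
    (ω : G'.HilbertFamily) : G.HilbertFamily :=
  ⟨ω.H, F.map (G'.rep ω)⟩

namespace CStar

variable {G G' : Ultragraph.{u}}

open scoped CStarAlgebra in
theorem hom_ext {A : Type*} [NonUnitalCStarAlgebra A] {φ ψ : G.CStar →⋆ₙₐ[ℂ] A}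
    (hs : ∀ e, φ (G.gen.s e) = ψ (G.gen.s e)) (hp : ∀ X, φ (G.gen.p X) = ψ (G.gen.p X)) :
    φ = ψ := by
  have htop := G.eq_top_of_gen_mem (NonUnitalStarAlgHom.equalizer φ ψ)
    (isClosed_eq (map_continuous φ) (map_continuous ψ)) hs hp
  ext1 a
  have ha : a ∈ NonUnitalStarAlgHom.equalizer φ ψ := htop ▸ trivial
  exact ha

open scoped CStarAlgebra in
theorem map_mem_of_gen_mem {A : Type*} [NonUnitalCStarAlgebra A] (φ : G.CStar →⋆ₙₐ[ℂ] A)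
    {S : NonUnitalStarSubalgebra ℂ A} (hS : IsClosed (S : Set A))
    (hs : ∀ e, φ (G.gen.s e) ∈ S) (hp : ∀ X, φ (G.gen.p X) ∈ S) (a : G.CStar) : φ a ∈ S := by
  have htop := G.eq_top_of_gen_mem (S.comap φ) (hS.preimage (map_continuous φ)) hs hp
  have ha : a ∈ S.comap φ := htop ▸ trivial
  exact ha

/-- The homomorphism from `C*(G)` to the product of all representations of `C*(G')` that a
Cuntz–Krieger `G`-family in `C*(G')` induces. -/
noncomputable def liftAmbient (F : G.CKFamily G'.CStar) : G.CStar →⋆ₙₐ[ℂ] G'.Ambient where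
  toFun a := ⟨fun ω => G.rep (F.pullback ω) a, memℓp_infty ⟨‖a‖, by
    rintro _ ⟨ω, rfl⟩
    exact NonUnitalStarAlgHom.norm_apply_le (G.rep (F.pullback ω)) a⟩⟩
  map_smul' c a := lp.ext (funext fun ω => map_smul (G.rep (F.pullback ω)) c a)
  map_zero' := lp.ext (funext fun ω => map_zero (G.rep (F.pullback ω)))
  map_add' a b := lp.ext (funext fun ω => map_add (G.rep (F.pullback ω)) a b)
  map_mul' a b := lp.ext (funext fun ω => map_mul (G.rep (F.pullback ω)) a b)
  map_star' a := lp.ext (funext fun ω => map_star (G.rep (F.pullback ω)) a)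

theorem liftAmbient_mem (F : G.CKFamily G'.CStar) (a : G.CStar) :
    liftAmbient F a ∈ G'.cstarSub :=
  map_mem_of_gen_mem (liftAmbient F) (NonUnitalStarSubalgebra.isClosed_topologicalClosure _)
    (fun e => (F.s e).2) (fun X => (F.p X).2) a

/-- The homomorphism `C*(G) → C*(G')` that maps the canonical generators to a given
Cuntz–Krieger `G`-family. -/
noncomputable def lift (F : G.CKFamily G'.CStar) : G.CStar →⋆ₙₐ[ℂ] G'.CStar :=
  NonUnitalStarAlgHom.codRestrict (liftAmbient F) G'.cstarSub (liftAmbient_mem F)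

theorem lift_s (F : G.CKFamily G'.CStar) (e : G.E) : lift F (G.gen.s e) = F.s e := rfl

end CStar

section RightIdeal

variable {A : Type*} [NonUnitalRing A] [StarRing A] [Module ℂ A] [StarModule ℂ A]
  [IsScalarTower ℂ A A]

/-- The largest `*`-subalgebra contained in a right ideal. The right ideal is only assumed to be
an additive subgroup, so that two-sided ideals of rings are covered. -/
def rightIdealCore (R : AddSubgroup A) (hR : ∀ a ∈ R, ∀ b, a * b ∈ R) :
    NonUnitalStarSubalgebra ℂ A where
  carrier := {a | ∀ c : ℂ, c • a ∈ R ∧ c • star a ∈ R}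
  add_mem' ha hb c := by
    simp only [star_add, smul_add]
    exact ⟨R.add_mem (ha c).1 (hb c).1, R.add_mem (ha c).2 (hb c).2⟩
  zero_mem' c := by simp only [star_zero, smul_zero, R.zero_mem, and_self]
  mul_mem' {a b} ha hb c := by
    rw [star_mul, ← smul_mul_assoc, ← smul_mul_assoc]
    exact ⟨hR _ (ha c).1 _, hR _ (hb c).2 _⟩
  smul_mem' d a ha c := by
    rw [star_smul, smul_smul, smul_smul]
    exact ⟨(ha _).1, (ha _).2⟩
  star_mem' {a} ha c := by
    rw [star_star]
    exact ⟨(ha c).2, (ha c).1⟩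

variable {R : AddSubgroup A} {hR : ∀ a ∈ R, ∀ b, a * b ∈ R}

theorem mem_of_mem_rightIdealCore {a : A} (ha : a ∈ rightIdealCore R hR) : a ∈ R :=
  one_smul ℂ a ▸ (ha 1).1

theorem mem_rightIdealCore_of_mul_eq [SMulCommClass ℂ A A] {a x y : A} (hx : x ∈ R)
    (hxa : x * a = a) (hy : y ∈ R) (hya : y * star a = star a) :
    a ∈ rightIdealCore R hR := fun c => by
  rw [← hxa, ← mul_smul_comm, hxa, ← hya, ← mul_smul_comm]
  exact ⟨hR x hx _, hR y hy _⟩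

theorem isClosed_rightIdealCore [TopologicalSpace A] [ContinuousStar A] [ContinuousConstSMul ℂ A]
    (hclosed : IsClosed (R : Set A)) : IsClosed (rightIdealCore R hR : Set A) := by
  have : (rightIdealCore R hR : Set A) =
      ⋂ c : ℂ, (c • ·) ⁻¹' (R : Set A) ∩ (c • star ·) ⁻¹' (R : Set A) := by
    ext a
    simp only [Set.mem_iInter]
    rfl
  rw [this]
  exact isClosed_iInter fun c => (hclosed.preimage (continuous_const_smul c)).inter
    (hclosed.preimage (continuous_star.const_smul c))

end RightIdeal

theorem CStar.mem_of_p_mem {G : Ultragraph.{u}} {R : AddSubgroup G.CStar}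
    (hclosed : IsClosed (R : Set G.CStar)) (hmul : ∀ a ∈ R, ∀ b, a * b ∈ R)
    (hvert : ∀ v, G.gen.p (G.vert v) ∈ R) (hrng : ∀ e, G.gen.p (G.rng e) ∈ R) (a : G.CStar) :
    a ∈ R := by
  have htop := G.eq_top_of_gen_mem (rightIdealCore R hmul) (isClosed_rightIdealCore hclosed)
    (fun e => mem_rightIdealCore_of_mul_eq (hvert _) (G.gen.p_vert_mul_s e) (hrng e)
      (G.gen.p_rng_mul_star_s e))
    (fun X => by
      have hX := G.gen.p_mem_of_vert_mem_of_rng_mem hmul hvert hrng X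
      exact mem_rightIdealCore_of_mul_eq hX (G.gen.p_mul_self X) hX
        (by rw [G.gen.star_p, G.gen.p_mul_self]))
  exact mem_of_mem_rightIdealCore (htop ▸ trivial : a ∈ rightIdealCore R hmul)

/-! ### Vertices and edges of a desingularization -/

/-- The singular vertices, at which tails are added. -/
abbrev SingularVertex (G : Ultragraph.{u}) : Type u := {v : G.V // G.IsSingular v}

/-- The infinite emitters, whose emitted edges are redistributed along a tail. -/
abbrev InfiniteEmitter (G : Ultragraph.{u}) : Type u := {v : G.V // G.IsInfiniteEmitter v}

/-- The edges that a desingularization keeps. -/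
abbrev KeptEdge (G : Ultragraph.{u}) : Type u := {e : G.E // ¬ G.IsInfiniteEmitter (G.s e)}

/-- An infinite emitter, as a singular vertex. -/
def InfiniteEmitter.toSingular {G : Ultragraph.{u}} (v : G.InfiniteEmitter) : G.SingularVertex :=
  ⟨v.1, .inr v.2⟩

section Edges

variable {G : Ultragraph.{u}} (g : G.EmitterListing)

/-- A kept edge, as an edge of the desingularization. -/
def keptEdge (e : G.KeptEdge) : (G.desingularization g).E := .inl e

/-- The tail edge from `v_n` to `v_{n+1}`. -/
def tailEdge (v : G.SingularVertex) (n : ℕ) : (G.desingularization g).E := .inr (.inl (v, n))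

/-- The edge that leaves the tail at `v_n` and replaces the edge `g v n`. -/
def emitEdge (v : G.InfiniteEmitter) (n : ℕ) : (G.desingularization g).E := .inr (.inr (v, n))

/-- The vertex `v_n` of the tail at `v = v_0`, as a vertex of the desingularization. -/
def tailVert (v : G.SingularVertex) (n : ℕ) : (G.desingularization g).V := tailVertex v n

variable {g}

theorem vert_cases {P : (G.desingularization g).V → Prop} (incl : ∀ v, P (G.inclV g v))
    (tail : ∀ v n, P (tailVert g v (n + 1))) : ∀ x, P x
  | .inl v => incl v
  | .inr (v, n) => tail v n

theorem edge_cases {P : (G.desingularization g).E → Prop} (kept : ∀ e, P (keptEdge g e))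
    (tail : ∀ v n, P (tailEdge g v n)) (emit : ∀ v n, P (emitEdge g v n)) : ∀ e, P e
  | .inl e => kept e
  | .inr (.inl (v, n)) => tail v n
  | .inr (.inr (v, n)) => emit v n

theorem edge_kept_or_listed (g : G.EmitterListing) {P : G.E → Prop}
    (kept : ∀ e : G.KeptEdge, P e.1) (listed : ∀ v n, P (g v n).1) (e : G.E) : P e := by
  by_cases h : G.IsInfiniteEmitter (G.s e)
  · have := listed ⟨G.s e, h⟩ ((g ⟨G.s e, h⟩).symm ⟨e, rfl⟩)
    rwa [Equiv.apply_symm_apply] at this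
  · exact kept ⟨e, h⟩

theorem listed_inj {v v' : G.InfiniteEmitter} {n n' : ℕ} :
    (g v n).1 = (g v' n').1 ↔ v = v' ∧ n = n' := by
  refine ⟨fun h => ?_, fun ⟨hv, hn⟩ => hv ▸ hn ▸ rfl⟩
  obtain rfl : v = v' := Subtype.ext ((g v n).2.symm.trans ((congrArg G.s h).trans (g v' n').2))
  exact ⟨rfl, (g v).injective (Subtype.ext h)⟩

theorem source_keptEdge (e : G.KeptEdge) :
    (G.desingularization g).s (keptEdge g e) = G.inclV g (G.s e.1) := rfl

theorem source_tailEdge (v : G.SingularVertex) (n : ℕ) :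
    (G.desingularization g).s (tailEdge g v n) = tailVert g v n := rfl

theorem source_emitEdge (v : G.InfiniteEmitter) (n : ℕ) :
    (G.desingularization g).s (emitEdge g v n) = tailVert g v.toSingular n := rfl

theorem rng_keptEdge (e : G.KeptEdge) :
    (G.desingularization g).rng (keptEdge g e) = (G.rng e.1).toDesing g := rfl

theorem rng_tailEdge (v : G.SingularVertex) (n : ℕ) :
    (G.desingularization g).rng (tailEdge g v n) =
      (G.desingularization g).vert (tailVert g v (n + 1)) := rfl

theorem rng_emitEdge (v : G.InfiniteEmitter) (n : ℕ) :
    (G.desingularization g).rng (emitEdge g v n) = (G.rng (g v n).1).toDesing g := rfl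

theorem toDesing_vert (v : G.V) :
    (G.vert v).toDesing g = (G.desingularization g).vert (G.inclV g v) :=
  GenSet.ext Set.image_singleton

theorem inclV_inj {v w : G.V} : G.inclV g v = G.inclV g w ↔ v = w := Sum.inl_injective.eq_iff

theorem tailVert_inj {v w : G.SingularVertex} {n m : ℕ} :
    tailVert g v n = tailVert g w m ↔ v = w ∧ n = m := by
  refine ⟨fun h => ?_, fun ⟨hv, hn⟩ => hv ▸ hn ▸ rfl⟩
  match n, m, h with
  | 0, 0, h => exact ⟨Subtype.ext (Sum.inl_injective h), rfl⟩
  | 0, m + 1, h => exact absurd h Sum.inl_ne_inr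
  | n + 1, 0, h => exact absurd h Sum.inr_ne_inl
  | n + 1, m + 1, h =>
    obtain ⟨rfl, rfl⟩ := Prod.ext_iff.1 (Sum.inr_injective h)
    exact ⟨rfl, rfl⟩

theorem tailVert_eq_inclV_iff {v : G.SingularVertex} {n : ℕ} {w : G.V} :
    tailVert g v n = G.inclV g w ↔ v.1 = w ∧ n = 0 := by
  cases n with
  | zero => exact inclV_inj.trans (and_iff_left rfl).symm
  | succ n => exact iff_of_false Sum.inr_ne_inl fun h => n.succ_ne_zero h.2

theorem disjoint_toDesing_tailVert (X : G.GenSet) (v : G.SingularVertex) (n : ℕ) :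
    Disjoint (X.toDesing g).set ((G.desingularization g).vert (tailVert g v (n + 1))).set :=
  Set.disjoint_singleton_right.2 fun ⟨_, _, h⟩ =>
    n.succ_ne_zero (tailVert_eq_inclV_iff.1 h.symm).2

theorem not_isSingular_of_finite_of_nonempty {v : G.V} (hfin : {e | G.s e = v}.Finite)
    (hne : {e | G.s e = v}.Nonempty) : ¬ G.IsSingular v := by
  rintro (hsink | hinf)
  exacts [hne.ne_empty hsink, hinf hfin]

theorem KeptEdge.not_isSingular_source (e : G.KeptEdge) : ¬ G.IsSingular (G.s e.1) :=
  not_isSingular_of_finite_of_nonempty (Set.not_infinite.1 e.2) ⟨e.1, rfl⟩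

theorem source_eq_tailVert_iff {e : (G.desingularization g).E} {v : G.SingularVertex} {n : ℕ} :
    (G.desingularization g).s e = tailVert g v n ↔
      e = tailEdge g v n ∨ ∃ h : G.IsInfiniteEmitter v.1, e = emitEdge g ⟨v.1, h⟩ n := by
  constructor
  · intro h
    induction e using edge_cases with
    | kept e =>
      exact absurd ((tailVert_eq_inclV_iff.1 h.symm).1 ▸ v.2) e.not_isSingular_source
    | tail w m =>
      obtain ⟨rfl, rfl⟩ := tailVert_inj.1 h
      exact .inl rfl
    | emit w m =>
      obtain ⟨rfl, rfl⟩ := tailVert_inj.1 h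
      exact .inr ⟨w.2, rfl⟩
  · rintro (rfl | ⟨_, rfl⟩) <;> rfl

theorem source_eq_inclV_iff {e : (G.desingularization g).E} {v : G.V} (hv : ¬ G.IsSingular v) :
    (G.desingularization g).s e = G.inclV g v ↔
      ∃ e' : G.KeptEdge, G.s e'.1 = v ∧ e = keptEdge g e' := by
  constructor
  · intro h
    induction e using edge_cases with
    | kept e => exact ⟨e, inclV_inj.1 h, rfl⟩
    | tail w m => exact absurd ((tailVert_eq_inclV_iff.1 h).1 ▸ w.2) hv
    | emit w m => exact absurd ((tailVert_eq_inclV_iff.1 h).1 ▸ .inr w.2) hv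
  · rintro ⟨e', rfl, rfl⟩
    rfl

variable (g) in
open Classical in
theorem sum_edges_tailVert {M : Type*} [AddCommMonoid M] (v : G.SingularVertex) (n : ℕ)
    (hfin : {e | (G.desingularization g).s e = tailVert g v n}.Finite)
    (f : (G.desingularization g).E → M) :
    ∑ e ∈ hfin.toFinset, f e = f (tailEdge g v n) +
      if h : G.IsInfiniteEmitter v.1 then f (emitEdge g ⟨v.1, h⟩ n) else 0 := by
  split_ifs with h
  · rw [← Finset.sum_pair (f := f) (show tailEdge g v n ≠ emitEdge g ⟨v.1, h⟩ n from nofun)]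
    congr 1
    ext e
    simp only [Set.Finite.mem_toFinset, Set.mem_ofPred_eq, source_eq_tailVert_iff, h,
      exists_true_left, Finset.mem_insert, Finset.mem_singleton]
  · rw [add_zero, ← Finset.sum_singleton f]
    congr 1
    ext e
    simp only [Set.Finite.mem_toFinset, Set.mem_ofPred_eq, source_eq_tailVert_iff, h,
      IsEmpty.exists_iff, or_false, Finset.mem_singleton]

theorem finite_edges_tailVert (v : G.SingularVertex) (n : ℕ) :
    {e | (G.desingularization g).s e = tailVert g v n}.Finite := by
  refine ((Set.finite_singleton (tailEdge g v n)).union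
    (Set.finite_range fun h : G.IsInfiniteEmitter v.1 => emitEdge g ⟨v.1, h⟩ n)).subset ?_
  rintro e he
  exact (source_eq_tailVert_iff.1 he).imp_right fun ⟨h, he⟩ => ⟨h, he.symm⟩

theorem sum_edges_inclV {M : Type*} [AddCommMonoid M] {v : G.V} (hv : ¬ G.IsSingular v)
    (hfin : {e | G.s e = v}.Finite)
    (hfin' : {e | (G.desingularization g).s e = G.inclV g v}.Finite)
    {f : G.E → M} {f' : (G.desingularization g).E → M}
    (hf : ∀ e : G.KeptEdge, f' (keptEdge g e) = f e.1) :
    ∑ e ∈ hfin'.toFinset, f' e = ∑ e ∈ hfin.toFinset, f e := by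
  have hkept : ∀ e, G.s e = v → ¬ G.IsInfiniteEmitter (G.s e) := fun e he h => hv (.inr (he ▸ h))
  refine (Finset.sum_bij
    (fun e he => keptEdge g ⟨e, hkept e (hfin.mem_toFinset.1 he)⟩) ?_ ?_ ?_ ?_).symm
  · exact fun e he => hfin'.mem_toFinset.2 (congrArg (G.inclV g) (hfin.mem_toFinset.1 he))
  · exact fun e _ f _ h => congrArg Subtype.val (Sum.inl_injective h)
  · intro e he
    obtain ⟨e', he', rfl⟩ := (source_eq_inclV_iff hv).1 (hfin'.mem_toFinset.1 he)
    exact ⟨e'.1, hfin.mem_toFinset.2 he', rfl⟩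
  · exact fun e he => (hf ⟨e, _⟩).symm

theorem finite_edges_inclV {v : G.V} (hv : ¬ G.IsSingular v) :
    {e | (G.desingularization g).s e = G.inclV g v}.Finite := by
  have hfin : {e | G.s e = v}.Finite := Set.not_infinite.1 fun h => hv (.inr h)
  refine ((hfin.preimage Subtype.val_injective.injOn).image (keptEdge g)).subset ?_
  rintro e he
  obtain ⟨e', he', rfl⟩ := (source_eq_inclV_iff hv).1 he
  exact ⟨e', he', rfl⟩

end Edges

/-! ### Remainder projections -/

namespace CKFamily

section Remainder

variable {G : Ultragraph.{u}} {A : Type*} [NonUnitalRing A] [StarRing A] (F : G.CKFamily A)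
  (g : G.EmitterListing)

theorem isStarProjection_s_mul_star (e : G.E) : IsStarProjection (F.s e * star (F.s e)) :=
  ⟨by rw [IsIdempotentElem, ← mul_assoc, F.partialIsometry], .mul_star_self _⟩

open Classical in
/-- The range projection of the `n`-th edge in the list of the edges that leave a singular
vertex; it is `0` at a sink. -/
noncomputable def listedProj (v : G.SingularVertex) (n : ℕ) : A :=
  if h : G.IsInfiniteEmitter v.1 then F.s (g ⟨v.1, h⟩ n).1 * star (F.s (g ⟨v.1, h⟩ n).1) else 0

/-- The part of the projection at a singular vertex that is left after the range projections of
the first `n` listed edges have been removed. -/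
noncomputable def remainder (v : G.SingularVertex) (n : ℕ) : A :=
  F.p (G.vert v.1) - ∑ j ∈ Finset.range n, F.listedProj g v j

theorem listedProj_toSingular (v : G.InfiniteEmitter) (n : ℕ) :
    F.listedProj g v.toSingular n = F.s (g v n).1 * star (F.s (g v n).1) := dif_pos v.2

theorem listedProj_mul_s (v : G.InfiniteEmitter) (n m : ℕ) :
    F.listedProj g v.toSingular n * F.s (g v m).1 = if n = m then F.s (g v m).1 else 0 := by
  rw [listedProj_toSingular]
  split_ifs with h
  · rw [h, F.partialIsometry]
  · rw [mul_assoc, F.orthogonal_ranges _ _ fun he => h (listed_inj.1 he).2, mul_zero]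

theorem isStarProjection_listedProj (v : G.SingularVertex) (n : ℕ) :
    IsStarProjection (F.listedProj g v n) := by
  unfold listedProj
  split_ifs
  exacts [F.isStarProjection_s_mul_star _, .zero A]

theorem remainder_zero (v : G.SingularVertex) : F.remainder g v 0 = F.p (G.vert v.1) := by
  rw [remainder, Finset.sum_range_zero, sub_zero]

theorem remainder_succ (v : G.SingularVertex) (n : ℕ) :
    F.remainder g v (n + 1) = F.remainder g v n - F.listedProj g v n := by
  rw [remainder, remainder, Finset.sum_range_succ, sub_add_eq_sub_sub]

theorem remainder_mul_s (v : G.InfiniteEmitter) (n m : ℕ) :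
    F.remainder g v.toSingular n * F.s (g v m).1 = if m < n then 0 else F.s (g v m).1 := by
  have hvert : F.p (G.vert v.1) * F.s (g v m).1 = F.s (g v m).1 :=
    F.p_mul_s_of_mem (g v m).2
  rw [remainder, sub_mul, Finset.sum_mul]
  simp only [listedProj_mul_s, Finset.sum_ite_eq', Finset.mem_range]
  rw [InfiniteEmitter.toSingular, hvert]
  split_ifs
  exacts [sub_self _, sub_zero _]

theorem remainder_mul_listedProj (v : G.SingularVertex) (n : ℕ) :
    F.remainder g v n * F.listedProj g v n = F.listedProj g v n := by
  by_cases h : G.IsInfiniteEmitter v.1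
  · have := F.remainder_mul_s g ⟨v.1, h⟩ n n
    rw [if_neg n.lt_irrefl] at this
    rw [show v = InfiniteEmitter.toSingular ⟨v.1, h⟩ from rfl, listedProj_toSingular, ← mul_assoc,
      this]
  · rw [listedProj, dif_neg h, mul_zero]

theorem isStarProjection_remainder (v : G.SingularVertex) (n : ℕ) :
    IsStarProjection (F.remainder g v n) := by
  induction n with
  | zero => exact F.remainder_zero g v ▸ F.projection _
  | succ n ih =>
    rw [remainder_succ]
    exact (F.isStarProjection_listedProj g v n).sub_of_mul_eq_right ih
      (F.remainder_mul_listedProj g v n)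

theorem star_remainder (v : G.SingularVertex) (n : ℕ) :
    star (F.remainder g v n) = F.remainder g v n :=
  (F.isStarProjection_remainder g v n).isSelfAdjoint.star_eq

theorem remainder_mul_self (v : G.SingularVertex) (n : ℕ) :
    F.remainder g v n * F.remainder g v n = F.remainder g v n :=
  (F.isStarProjection_remainder g v n).isIdempotentElem.eq

theorem remainder_mul_remainder_succ (v : G.SingularVertex) (n : ℕ) :
    F.remainder g v n * F.remainder g v (n + 1) = F.remainder g v (n + 1) := by
  rw [remainder_succ, mul_sub, remainder_mul_self, remainder_mul_listedProj]

end Remainder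

end CKFamily

/-! ### Restriction of families of a desingularization -/

namespace CKFamily

variable {G : Ultragraph.{u}} {g : G.EmitterListing}

section Restriction

variable {A : Type*} [NonUnitalRing A] [StarRing A] (F : (G.desingularization g).CKFamily A)

/-- The partial isometry of the path from `v` to `v_n` along the tail. -/
def tailPath (v : G.SingularVertex) : ℕ → A
  | 0 => F.p ((G.desingularization g).vert (tailVert g v 0))
  | n + 1 => tailPath v n * F.s (tailEdge g v n)

theorem tailPath_succ (v : G.SingularVertex) (n : ℕ) :
    F.tailPath v (n + 1) = F.tailPath v n * F.s (tailEdge g v n) := rfl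

theorem p_mul_tailPath (v : G.SingularVertex) (n : ℕ) :
    F.p ((G.desingularization g).vert (tailVert g v 0)) * F.tailPath v n = F.tailPath v n := by
  induction n with
  | zero => exact F.p_mul_self _
  | succ n ih => rw [tailPath_succ, ← mul_assoc, ih]

theorem tailPath_mul_p (v : G.SingularVertex) (n : ℕ) :
    F.tailPath v n * F.p ((G.desingularization g).vert (tailVert g v n)) = F.tailPath v n := by
  cases n with
  | zero => exact F.p_mul_self _
  | succ n => rw [tailPath_succ, mul_assoc, ← rng_tailEdge, F.s_mul_p_rng]

theorem star_tailPath_mul_self (v : G.SingularVertex) (n : ℕ) :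
    star (F.tailPath v n) * F.tailPath v n =
      F.p ((G.desingularization g).vert (tailVert g v n)) := by
  induction n with
  | zero => rw [tailPath, F.star_p, F.p_mul_self]
  | succ n ih =>
    rw [tailPath_succ, star_mul, mul_assoc, ← mul_assoc (star (F.tailPath v n)), ih,
      ← source_tailEdge, F.p_vert_mul_s, F.initial, rng_tailEdge]

/-- The partial isometry of the path from `v` that leaves the tail at `v_n`. -/
def exitPath (v : G.InfiniteEmitter) (n : ℕ) : A :=
  F.tailPath v.toSingular n * F.s (emitEdge g v n)

theorem star_tailPath_mul_exitPath (v : G.InfiniteEmitter) (n : ℕ) :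
    star (F.tailPath v.toSingular n) * F.exitPath v n = F.s (emitEdge g v n) := by
  rw [exitPath, ← mul_assoc, star_tailPath_mul_self, ← source_emitEdge, F.p_vert_mul_s]

theorem p_mul_exitPath (v : G.InfiniteEmitter) (n : ℕ) :
    F.p ((G.desingularization g).vert (G.inclV g v.1)) * F.exitPath v n = F.exitPath v n := by
  rw [exitPath, ← mul_assoc]
  exact congrArg (· * _) (F.p_mul_tailPath v.toSingular n)

theorem star_exitPath_mul_self (v : G.InfiniteEmitter) (n : ℕ) :
    star (F.exitPath v n) * F.exitPath v n = F.p ((G.rng (g v n).1).toDesing g) := by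
  conv_lhs => rw [exitPath, star_mul, mul_assoc, ← exitPath, star_tailPath_mul_exitPath]
  rw [F.initial, rng_emitEdge]

theorem star_exitPath_mul_tailPath (v : G.InfiniteEmitter) {n m : ℕ} (h : n < m) :
    star (F.exitPath v n) * F.tailPath v.toSingular m = 0 := by
  induction m, h using Nat.le_induction with
  | base =>
    have hne : emitEdge g v n ≠ tailEdge g v.toSingular n := nofun
    rw [tailPath_succ, exitPath, star_mul, mul_assoc, ← mul_assoc (star (F.tailPath _ n)),
      star_tailPath_mul_self, ← source_tailEdge, F.p_vert_mul_s, F.orthogonal_ranges _ _ hne]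
  | succ m _ ih => rw [tailPath_succ, ← mul_assoc, ih, zero_mul]

theorem star_exitPath_mul_exitPath (v : G.InfiniteEmitter) {n m : ℕ} (h : n ≠ m) :
    star (F.exitPath v n) * F.exitPath v m = 0 := by
  wlog hlt : n < m generalizing n m
  · rw [← star_star (F.exitPath v m), ← star_mul,
      this h.symm (h.lt_or_gt.resolve_left hlt), star_zero]
  · rw [exitPath.eq_1 F v m, ← mul_assoc, F.star_exitPath_mul_tailPath v hlt, zero_mul]

open Classical in
/-- The partial isometry that a family of the desingularization attaches to an edge of `G`. -/
noncomputable def restrictS (e : G.E) : A :=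
  if h : G.IsInfiniteEmitter (G.s e) then
    F.exitPath ⟨G.s e, h⟩ ((g ⟨G.s e, h⟩).symm ⟨e, rfl⟩)
  else F.s (keptEdge g ⟨e, h⟩)

theorem restrictS_kept (e : G.KeptEdge) : F.restrictS e.1 = F.s (keptEdge g e) := dif_neg e.2

theorem restrictS_listed (v : G.InfiniteEmitter) (n : ℕ) :
    F.restrictS (g v n).1 = F.exitPath v n := by
  have h : G.IsInfiniteEmitter (G.s (g v n).1) := (g v n).2.symm ▸ v.2
  have hlisted : (g ⟨_, h⟩ ((g ⟨_, h⟩).symm ⟨(g v n).1, rfl⟩)).1 = (g v n).1 := by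
    rw [Equiv.apply_symm_apply]
  obtain ⟨hv, hn⟩ := listed_inj.1 hlisted
  rw [restrictS, dif_pos h, hn, hv]

theorem p_mul_restrictS (e : G.E) :
    F.p ((G.desingularization g).vert (G.inclV g (G.s e))) * F.restrictS e = F.restrictS e := by
  induction e using edge_kept_or_listed g with
  | kept e => exact F.restrictS_kept e ▸ F.p_vert_mul_s (keptEdge g e)
  | listed v n => rw [restrictS_listed, (g v n).2, p_mul_exitPath]

theorem star_restrictS_mul_self (e : G.E) :
    star (F.restrictS e) * F.restrictS e = F.p ((G.rng e).toDesing g) := by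
  induction e using edge_kept_or_listed g with
  | kept e => exact F.restrictS_kept e ▸ F.initial (keptEdge g e)
  | listed v n => rw [restrictS_listed, star_exitPath_mul_self]

theorem star_restrictS_mul_restrictS {e f : G.E} (hne : e ≠ f) :
    star (F.restrictS e) * F.restrictS f = 0 := by
  by_cases hs : G.s e = G.s f
  · induction e using edge_kept_or_listed g with
    | kept e =>
      obtain ⟨f, rfl⟩ : ∃ f' : G.KeptEdge, f'.1 = f := ⟨⟨f, hs ▸ e.2⟩, rfl⟩
      rw [restrictS_kept, restrictS_kept]
      exact F.orthogonal_ranges _ _ fun h => hne (congrArg Subtype.val (Sum.inl_injective h))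
    | listed v n =>
      obtain ⟨m, hm⟩ := (g v).surjective ⟨f, hs.symm.trans (g v n).2⟩
      obtain rfl : (g v m).1 = f := congrArg Subtype.val hm
      rw [restrictS_listed, restrictS_listed]
      exact F.star_exitPath_mul_exitPath v fun h => hne (h ▸ rfl)
  · have hvert : Disjoint ((G.desingularization g).vert (G.inclV g (G.s e))).set
        ((G.desingularization g).vert (G.inclV g (G.s f))).set :=
      Set.disjoint_singleton.2 fun h => hs (inclV_inj.1 h)
    rw [← F.p_mul_restrictS e, ← F.p_mul_restrictS f, star_mul, F.star_p, mul_assoc,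
      ← mul_assoc (F.p _), F.p_mul_of_disjoint hvert, zero_mul, mul_zero]

/-- A Cuntz–Krieger family of the desingularization restricts to one of `G`: an edge `g_{n+1}`
that leaves an infinite emitter `v` is sent to the path `e_1 ⋯ e_n f_{n+1}`. -/
noncomputable def restrict : G.CKFamily A where
  s := F.restrictS
  p X := F.p (X.toDesing g)
  partialIsometry e := by
    rw [mul_assoc, star_restrictS_mul_self]
    induction e using edge_kept_or_listed g with
    | kept e => exact F.restrictS_kept e ▸ F.s_mul_p_rng (keptEdge g e)
    | listed v n => rw [restrictS_listed, exitPath, mul_assoc, ← rng_emitEdge, F.s_mul_p_rng]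
  orthogonal_ranges _ _ := F.star_restrictS_mul_restrictS
  projection _ := F.projection _
  p_empty := F.p_empty ▸ congrArg F.p (GenSet.ext (Set.image_empty _))
  p_inter X Y := by
    rw [F.p_inter]
    exact congrArg F.p (GenSet.ext (Set.image_inter Sum.inl_injective).symm)
  p_union X Y := by
    have hunion : GenSet.toDesing g ⟨X.set ∪ Y.set, X.isGenSet.union Y.isGenSet⟩ =
        ⟨_, (X.toDesing g).isGenSet.union (Y.toDesing g).isGenSet⟩ :=
      GenSet.ext (Set.image_union _ _ _)
    have hinter : GenSet.toDesing g ⟨X.set ∩ Y.set, X.isGenSet.inter Y.isGenSet⟩ =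
        ⟨_, (X.toDesing g).isGenSet.inter (Y.toDesing g).isGenSet⟩ :=
      GenSet.ext (Set.image_inter Sum.inl_injective)
    rw [hunion, hinter, F.p_union]
  initial := F.star_restrictS_mul_self
  final_le e := by rw [← mul_assoc, toDesing_vert, F.p_mul_restrictS]
  regular_sum v hfin hne := by
    have hv := not_isSingular_of_finite_of_nonempty hfin hne
    obtain ⟨e, rfl⟩ := hne
    rw [toDesing_vert, F.regular_sum _ (finite_edges_inclV hv)
      ⟨keptEdge g ⟨e, fun h => hv (.inr h)⟩, rfl⟩]
    exact sum_edges_inclV hv hfin _ fun e => by rw [restrictS_kept]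

open Classical in
theorem p_vert_tailVert (v : G.SingularVertex) (n : ℕ) :
    F.p ((G.desingularization g).vert (tailVert g v n)) =
      F.s (tailEdge g v n) * star (F.s (tailEdge g v n)) +
        if h : G.IsInfiniteEmitter v.1 then
          F.s (emitEdge g ⟨v.1, h⟩ n) * star (F.s (emitEdge g ⟨v.1, h⟩ n)) else 0 := by
  rw [F.regular_sum _ (finite_edges_tailVert v n) ⟨tailEdge g v n, rfl⟩]
  exact sum_edges_tailVert g v n _ fun e => F.s e * star (F.s e)

theorem tailPath_mul_star_self_eq_add (v : G.SingularVertex) (n : ℕ) :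
    F.tailPath v n * star (F.tailPath v n) =
      F.tailPath v (n + 1) * star (F.tailPath v (n + 1)) + F.restrict.listedProj g v n := by
  have htail : F.tailPath v n * star (F.tailPath v n) =
      F.tailPath v n * F.p ((G.desingularization g).vert (tailVert g v n)) *
        star (F.tailPath v n) := by rw [tailPath_mul_p]
  rw [htail, p_vert_tailVert, listedProj, mul_add, add_mul]
  congr 1
  · simp only [tailPath_succ, star_mul, mul_assoc]
  · split_ifs with h
    · change _ = F.restrictS (g ⟨v.1, h⟩ n).1 * star (F.restrictS (g ⟨v.1, h⟩ n).1)
      simp only [restrictS_listed, exitPath, star_mul, mul_assoc]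
      rfl
    · rw [mul_zero, zero_mul]

theorem tailPath_mul_star_self (v : G.SingularVertex) (n : ℕ) :
    F.tailPath v n * star (F.tailPath v n) = F.restrict.remainder g v n := by
  induction n with
  | zero =>
    rw [remainder_zero, tailPath, F.star_p, F.p_mul_self]
    exact congrArg F.p (toDesing_vert v.1).symm
  | succ n ih =>
    rw [remainder_succ, ← ih, F.tailPath_mul_star_self_eq_add v n, add_sub_cancel_right]

variable {B : Type*} [NonUnitalRing B] [StarRing B] [Module ℂ A] [Module ℂ B] (φ : A →⋆ₙₐ[ℂ] B)

theorem tailPath_map (v : G.SingularVertex) (n : ℕ) :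
    (F.map φ).tailPath v n = φ (F.tailPath v n) := by
  induction n with
  | zero => rfl
  | succ n ih => rw [tailPath_succ, tailPath_succ, ih, map_mul, map_s]

theorem restrictS_map (e : G.E) : (F.map φ).restrictS e = φ (F.restrictS e) := by
  induction e using edge_kept_or_listed g with
  | kept e => rw [restrictS_kept, restrictS_kept, map_s]
  | listed v n =>
    rw [restrictS_listed, restrictS_listed, exitPath, exitPath, tailPath_map, map_mul, map_s]

end Restriction

end CKFamily

/-! ### The limit projection -/

section Limit

variable {A : Type*} [NonUnitalNormedRing A]

/-- The elements `a` for which `x_n a` converges; they form a right ideal. -/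
def leftConvergent (x : ℕ → A) : AddSubgroup A where
  carrier := {a | ∃ l, Tendsto (fun n => x n * a) atTop (𝓝 l)}
  zero_mem' := ⟨0, by simp only [mul_zero, tendsto_const_nhds]⟩
  add_mem' := fun ⟨l, hl⟩ ⟨l', hl'⟩ => ⟨l + l', by simpa only [mul_add] using hl.add hl'⟩
  neg_mem' := fun ⟨l, hl⟩ => ⟨-l, by simpa only [mul_neg] using hl.neg⟩

theorem mul_mem_leftConvergent {x : ℕ → A} {a : A} (ha : a ∈ leftConvergent x) (b : A) :
    a * b ∈ leftConvergent x := by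
  obtain ⟨l, hl⟩ := ha
  exact ⟨l * b, by simpa only [mul_assoc] using hl.mul_const b⟩

theorem isClosed_leftConvergent [CompleteSpace A] {x : ℕ → A} (hx : ∀ n, ‖x n‖ ≤ 1) :
    IsClosed (leftConvergent x : Set A) := by
  have hcauchy : (leftConvergent x : Set A) = {a | CauchySeq fun n => x n * a} :=
    Set.ext fun a => ⟨fun ⟨_, hl⟩ => hl.cauchySeq, cauchySeq_tendsto_of_complete⟩
  rw [hcauchy]
  refine isClosed_setOf_cauchySeq
    (LipschitzWith.uniformEquicontinuous _ 1 fun n => LipschitzWith.of_dist_le_mul fun a b => ?_)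
  rw [dist_eq_norm, dist_eq_norm, ← mul_sub]
  exact (norm_mul_le _ _).trans (mul_le_mul_of_nonneg_right (hx n) (norm_nonneg _))

end Limit

section Exhaustion

variable {G : Ultragraph.{u}}

/-- A sequence in `𝒢⁰` every element of `𝒢⁰` is eventually contained in, such as the sequence of
the sets `A_n`. -/
def IsExhaustion (Y : ℕ → G.GenSet) : Prop := ∀ X : G.GenSet, ∀ᶠ n in atTop, X.set ⊆ (Y n).set

theorem isExhaustion_initialGenSet {w : ℕ → Option G.V} (hw : ∀ v, ∃ i, w i = some v)
    {h : ℕ → Option G.E} (hh : ∀ e, ∃ i, h i = some e) :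
    IsExhaustion (G.initialGenSet w h) := fun X => by
  induction X using GenSet.induction with
  | empty => exact .of_forall fun n => Set.empty_subset _
  | vert v =>
    obtain ⟨i, hi⟩ := hw v
    filter_upwards [eventually_gt_atTop i] with n hn
    exact Set.singleton_subset_iff.2 (.inl ⟨i, hn, hi⟩)
  | rng e =>
    obtain ⟨i, hi⟩ := hh e
    filter_upwards [eventually_gt_atTop i] with n hn
    exact fun v hv => .inr ⟨i, hn, e, hi, hv⟩
  | inter X Y hX _ => exact hX.mono fun n hn => Set.inter_subset_left.trans hn
  | union X Y hX hY => exact (hX.and hY).mono fun n hn => Set.union_subset hn.1 hn.2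

variable {g : G.EmitterListing}

theorem CStar.mem_of_p_toDesing_mem {R : AddSubgroup (G.desingularization g).CStar}
    (hclosed : IsClosed (R : Set (G.desingularization g).CStar))
    (hmul : ∀ a ∈ R, ∀ b, a * b ∈ R)
    (hincl : ∀ X : G.GenSet, (G.desingularization g).gen.p (X.toDesing g) ∈ R)
    (htail : ∀ v n, (G.desingularization g).gen.p
      ((G.desingularization g).vert (tailVert g v (n + 1))) ∈ R)
    (a : (G.desingularization g).CStar) : a ∈ R := by
  refine CStar.mem_of_p_mem hclosed hmul (fun x => ?_) (fun e => ?_) a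
  · induction x using vert_cases with
    | incl v => exact toDesing_vert (g := g) v ▸ hincl (G.vert v)
    | tail v n => exact htail v n
  · induction e using edge_cases with
    | kept e => exact hincl (G.rng e.1)
    | tail v n => exact htail v n
    | emit v n => exact hincl (G.rng (g v n).1)

variable (g) in
/-- The projections `q_{Y_n}` of the desingularization, as multipliers. -/
noncomputable def limitingProj (Y : ℕ → G.GenSet) (n : ℕ) :
    𝓜(ℂ, (G.desingularization g).CStar) :=
  ((G.desingularization g).gen.p ((Y n).toDesing g) : (G.desingularization g).CStar)

variable {Y : ℕ → G.GenSet}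

theorem isStarProjection_limitingProj (n : ℕ) : IsStarProjection (limitingProj g Y n) :=
  ((G.desingularization g).gen.projection _).map (DoubleCentralizer.coeHom (𝕜 := ℂ))

theorem IsExhaustion.mem_leftConvergent (hY : IsExhaustion Y) (a : (G.desingularization g).CStar) :
    a ∈ leftConvergent fun n => (G.desingularization g).gen.p ((Y n).toDesing g) := by
  set q := (G.desingularization g).gen.p
  have hincl : ∀ X : G.GenSet, ∀ᶠ n in atTop,
      q (X.toDesing g) = q ((Y n).toDesing g) * q (X.toDesing g) := fun X =>
    (hY X).mono fun n hn => (CKFamily.p_mul_of_superset _ (Set.image_mono hn)).symm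
  have htail : ∀ v m n,
      0 = q ((Y n).toDesing g) * q ((G.desingularization g).vert (tailVert g v (m + 1))) :=
    fun v m n => (CKFamily.p_mul_of_disjoint _ (disjoint_toDesing_tailVert _ v m)).symm
  exact CStar.mem_of_p_toDesing_mem (isClosed_leftConvergent fun n => CKFamily.norm_p_le _ _)
    (fun _ => mul_mem_leftConvergent)
    (fun X => ⟨_, tendsto_const_nhds.congr' (hincl X)⟩)
    (fun v m => ⟨0, tendsto_const_nhds.congr (htail v m)⟩) a

theorem IsExhaustion.exists_strictlyTendsto (hY : IsExhaustion Y) :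
    ∃ p, StrictlyTendsto (limitingProj g Y) p :=
  Ultragraph.exists_strictlyTendsto hY.mem_leftConvergent fun a => by
    obtain ⟨l, hl⟩ := hY.mem_leftConvergent (star a)
    refine ⟨star l, hl.star.congr fun n => ?_⟩
    rw [star_mul, star_star, CKFamily.star_p]
    rfl

variable {p : 𝓜(ℂ, (G.desingularization g).CStar)} {hp : IsStarProjection p}

theorem IsExhaustion.p_toDesing_mem_corner (hY : IsExhaustion Y)
    (hlim : StrictlyTendsto (limitingProj g Y) p) (X : G.GenSet) :
    (G.desingularization g).gen.p (X.toDesing g) ∈ corner p hp :=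
  hlim.mem_corner hp ((hY X).mono fun _ hn =>
    ⟨CKFamily.p_mul_of_superset _ (Set.image_mono hn),
      CKFamily.p_mul_of_subset _ (Set.image_mono hn)⟩)

theorem IsExhaustion.isFullCorner (hY : IsExhaustion Y)
    (hlim : StrictlyTendsto (limitingProj g Y) p) : IsFullCorner p hp := by
  intro J hJ hsub
  have hincl : ∀ X : G.GenSet, (G.desingularization g).gen.p (X.toDesing g) ∈ J := fun X =>
    hsub (hY.p_toDesing_mem_corner hlim X)
  have htail : ∀ v n,
      (G.desingularization g).gen.p ((G.desingularization g).vert (tailVert g v n)) ∈ J := by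
    intro v n
    induction n with
    | zero => exact toDesing_vert (g := g) v.1 ▸ hincl (G.vert v.1)
    | succ n ih =>
      rw [← rng_tailEdge, ← CKFamily.initial, ← CKFamily.p_vert_mul_s, source_tailEdge]
      exact J.mul_mem_left _ _ (J.mul_mem_right _ _ ih)
  exact eq_top_iff.2 fun a _ => CStar.mem_of_p_toDesing_mem (R := AddSubgroup.ofClass J) hJ
    (fun x hx b => J.mul_mem_right x b hx) hincl (fun v n => htail v (n + 1)) a

end Exhaustion

/-! ### Matrices of operators -/

/-- The maps `x ↦ x ⊗ e_{ij}` from a `*`-algebra `A` to a `*`-algebra `B` that contains the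
matrices over `A` with finitely many nonzero entries. -/
structure MatrixSystem (ι A B : Type*) [NonUnitalRing A] [StarRing A] [Module ℂ A]
    [NonUnitalRing B] [StarRing B] [Module ℂ B] where
  single : ι → ι → A →ₗ[ℂ] B
  single_mul_single_same : ∀ i j k x y, single i j x * single j k y = single i k (x * y)
  single_mul_single_of_ne : ∀ i j j' k x y, j ≠ j' → single i j x * single j' k y = 0
  star_single : ∀ i j x, star (single i j x) = single j i (star x)

/-- The embedding of the `(i, i)` entry, as a `*`-homomorphism. -/
def MatrixSystem.diag {ι A B : Type*} [NonUnitalRing A] [StarRing A] [Module ℂ A]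
    [NonUnitalRing B] [StarRing B] [Module ℂ B] (M : MatrixSystem ι A B) (i : ι) :
    A →⋆ₙₐ[ℂ] B where
  toFun := M.single i i
  map_smul' := map_smul _
  map_zero' := map_zero _
  map_add' := map_add _
  map_mul' x y := (M.single_mul_single_same i i i x y).symm
  map_star' x := (M.star_single i i x).symm

section HilbertMatrix

variable {ι : Type*} {H : Type*} [NormedAddCommGroup H] [InnerProductSpace ℂ H] [CompleteSpace H]

open Classical in
/-- The inclusion of the `i`-th summand into the Hilbert space sum of copies of `H`. -/
noncomputable def summand (i : ι) : H →L[ℂ] lp (fun _ : ι => H) 2 :=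
  lp.singleContinuousLinearMap ℂ (fun _ : ι => H) 2 i

theorem adjoint_summand_apply (i : ι) (f : lp (fun _ : ι => H) 2) :
    ContinuousLinearMap.adjoint (summand i) f = f i :=
  ext_inner_left ℂ fun x => by
    classical
    rw [ContinuousLinearMap.adjoint_inner_right]
    exact lp.inner_single_left (𝕜 := ℂ) (G := fun _ : ι => H) i x f

theorem adjoint_summand_comp_summand (i : ι) :
    (ContinuousLinearMap.adjoint (summand i)).comp (summand i) = .id ℂ H := by
  ext1 x
  rw [ContinuousLinearMap.comp_apply, adjoint_summand_apply]
  classical exact lp.single_apply_self (E := fun _ : ι => H) 2 i x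

theorem adjoint_summand_comp_summand_of_ne {i j : ι} (h : i ≠ j) :
    (ContinuousLinearMap.adjoint (summand (H := H) i)).comp (summand j) = 0 := by
  ext1 x
  rw [ContinuousLinearMap.comp_apply, adjoint_summand_apply]
  classical exact lp.single_apply_ne (E := fun _ : ι => H) 2 j x h

variable (ι H) in
/-- The operators on a Hilbert space sum of copies of `H` with a single nonzero entry. -/
noncomputable def hilbertMatrixSystem :
    MatrixSystem ι (H →L[ℂ] H) (lp (fun _ : ι => H) 2 →L[ℂ] lp (fun _ : ι => H) 2) where
  single i j :=
    { toFun := fun x => (summand i).comp (x.comp (ContinuousLinearMap.adjoint (summand j)))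
      map_add' := fun x y => by rw [ContinuousLinearMap.add_comp, ContinuousLinearMap.comp_add]
      map_smul' := fun c x => by
        rw [ContinuousLinearMap.smul_comp, ContinuousLinearMap.comp_smul, RingHom.id_apply] }
  single_mul_single_same i j k x y := by
    change (summand i).comp (x.comp (((ContinuousLinearMap.adjoint (summand j)).comp
      (summand j)).comp (y.comp (ContinuousLinearMap.adjoint (summand k))))) = _
    rw [adjoint_summand_comp_summand]
    rfl
  single_mul_single_of_ne i j j' k x y h := by
    change (summand i).comp (x.comp (((ContinuousLinearMap.adjoint (summand j)).comp
      (summand j')).comp (y.comp (ContinuousLinearMap.adjoint (summand k))))) = _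
    rw [adjoint_summand_comp_summand_of_ne h, ContinuousLinearMap.zero_comp,
      ContinuousLinearMap.comp_zero, ContinuousLinearMap.comp_zero]
  star_single i j x := by
    simp only [LinearMap.coe_mk, AddHom.coe_mk, ContinuousLinearMap.star_eq_adjoint,
      ContinuousLinearMap.adjoint_comp, ContinuousLinearMap.adjoint_adjoint,
      ContinuousLinearMap.comp_assoc]

theorem hilbertMatrixSystem_diag_injective (i : ι) :
    Function.Injective ((hilbertMatrixSystem ι H).diag i) := by
  refine Function.LeftInverse.injective
    (g := fun T => (ContinuousLinearMap.adjoint (summand i)).comp (T.comp (summand i))) fun x => ?_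
  change ((ContinuousLinearMap.adjoint (summand i)).comp (summand i)).comp
    (x.comp ((ContinuousLinearMap.adjoint (summand i)).comp (summand i))) = x
  rw [adjoint_summand_comp_summand, ContinuousLinearMap.comp_id, ContinuousLinearMap.id_comp]

end HilbertMatrix

/-! ### Dilation of families to the desingularization -/

section GenSets

variable {G : Ultragraph.{u}} {g : G.EmitterListing}

variable (g) in
/-- The inclusion of the added vertices into those of the desingularization. -/
def addedVert (y : G.SingularVertex × ℕ) : (G.desingularization g).V := tailVert g y.1 (y.2 + 1)

theorem addedVert_injective : Function.Injective (addedVert g) := Sum.inr_injective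

theorem GenSet.desingularization_induction {P : (G.desingularization g).GenSet → Prop}
    (toDesing : ∀ X : G.GenSet, P (X.toDesing g))
    (added : ∀ y, P ((G.desingularization g).vert (addedVert g y)))
    (inter : ∀ X Y : (G.desingularization g).GenSet, P X → P Y →
      P ⟨X.set ∩ Y.set, X.isGenSet.inter Y.isGenSet⟩)
    (union : ∀ X Y : (G.desingularization g).GenSet, P X → P Y →
      P ⟨X.set ∪ Y.set, X.isGenSet.union Y.isGenSet⟩)
    (X : (G.desingularization g).GenSet) : P X := by
  induction X using GenSet.induction with
  | empty =>
    have h := toDesing ⟨∅, .empty⟩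
    rwa [show GenSet.toDesing g ⟨∅, .empty⟩ = ⟨∅, .empty⟩ from GenSet.ext (Set.image_empty _)] at h
  | vert x =>
    induction x using vert_cases with
    | incl v => exact toDesing_vert v ▸ toDesing (G.vert v)
    | tail v n => exact added (v, n)
  | rng e =>
    induction e using edge_cases with
    | kept e => exact toDesing (G.rng e.1)
    | tail v n => exact added (v, n)
    | emit v n => exact toDesing (G.rng (g v n).1)
  | inter X Y hX hY => exact inter X Y hX hY
  | union X Y hX hY => exact union X Y hX hY

theorem preimage_inclV_toDesing (X : G.GenSet) : G.inclV g ⁻¹' (X.toDesing g).set = X.set :=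
  Set.preimage_image_eq X.set Sum.inl_injective

theorem preimage_addedVert_toDesing (X : G.GenSet) : addedVert g ⁻¹' (X.toDesing g).set = ∅ :=
  Set.eq_empty_of_forall_notMem fun y hy =>
    Set.disjoint_left.1 (disjoint_toDesing_tailVert X y.1 y.2) hy rfl

theorem preimage_inclV_addedVert (y : G.SingularVertex × ℕ) : G.inclV g ⁻¹' {addedVert g y} = ∅ :=
  Set.eq_empty_of_forall_notMem fun _ h =>
    y.2.succ_ne_zero (tailVert_eq_inclV_iff.1 (Set.mem_singleton_iff.1 h).symm).2

theorem isGenSet_preimage_inclV (X : (G.desingularization g).GenSet) :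
    G.IsGenSet (G.inclV g ⁻¹' X.set) := by
  induction X using GenSet.desingularization_induction with
  | toDesing X => exact preimage_inclV_toDesing (g := g) X ▸ X.isGenSet
  | added y => exact preimage_inclV_addedVert (g := g) y ▸ .empty
  | inter _ _ hX hY => exact hX.inter hY
  | union _ _ hX hY => exact hX.union hY

theorem finite_preimage_addedVert (X : (G.desingularization g).GenSet) :
    (addedVert g ⁻¹' X.set).Finite := by
  induction X using GenSet.desingularization_induction with
  | toDesing X => exact preimage_addedVert_toDesing (g := g) X ▸ Set.finite_empty
  | added y => exact (Set.finite_singleton _).preimage addedVert_injective.injOn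
  | inter _ _ hX _ => exact hX.inter_of_left _
  | union _ _ hX hY => exact hX.union hY

/-- The vertices of `G` in a set of vertices of the desingularization. -/
def GenSet.base (X : (G.desingularization g).GenSet) : G.GenSet :=
  ⟨G.inclV g ⁻¹' X.set, isGenSet_preimage_inclV X⟩

/-- The added vertices in a set of vertices of the desingularization. -/
noncomputable def GenSet.added (X : (G.desingularization g).GenSet) :
    Finset (G.SingularVertex × ℕ) :=
  (finite_preimage_addedVert X).toFinset

theorem GenSet.base_toDesing (X : G.GenSet) : (X.toDesing g).base = X :=
  GenSet.ext (preimage_inclV_toDesing X)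

theorem GenSet.added_toDesing (X : G.GenSet) : (X.toDesing g).added = ∅ :=
  Set.Finite.toFinset_eq_empty.2 (preimage_addedVert_toDesing X)

theorem GenSet.added_inter [DecidableEq (G.SingularVertex × ℕ)]
    (X Y : (G.desingularization g).GenSet) :
    GenSet.added ⟨X.set ∩ Y.set, X.isGenSet.inter Y.isGenSet⟩ = X.added ∩ Y.added :=
  Set.Finite.toFinset_inter _ _ _

theorem GenSet.added_union [DecidableEq (G.SingularVertex × ℕ)]
    (X Y : (G.desingularization g).GenSet) :
    GenSet.added ⟨X.set ∪ Y.set, X.isGenSet.union Y.isGenSet⟩ = X.added ∪ Y.added :=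
  Set.Finite.toFinset_union _ _ _

theorem base_vert_addedVert (y : G.SingularVertex × ℕ) :
    ((G.desingularization g).vert (addedVert g y)).base = ⟨∅, .empty⟩ :=
  GenSet.ext (preimage_inclV_addedVert y)

theorem added_vert_addedVert (y : G.SingularVertex × ℕ) :
    ((G.desingularization g).vert (addedVert g y)).added = {y} := by
  ext z
  rw [GenSet.added, Set.Finite.mem_toFinset, Finset.mem_singleton]
  exact addedVert_injective.eq_iff

end GenSets

/-- The position of the vertex `v_n` among the blocks of a dilated family: all vertices of `G`
share the block `none`, and each added vertex has its own block. -/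
def tailBlock {G : Ultragraph.{u}} (v : G.SingularVertex) :
    ℕ → Option (G.SingularVertex × ℕ)
  | 0 => none
  | n + 1 => some (v, n)

namespace CKFamily

section Dilation

variable {G : Ultragraph.{u}} (g : G.EmitterListing) {A B : Type*} [NonUnitalRing A] [StarRing A]
  [Module ℂ A] [NonUnitalRing B] [StarRing B] [Module ℂ B] (F : G.CKFamily A)
  (M : MatrixSystem (Option (G.SingularVertex × ℕ)) A B)

/-- The sum of the projections that the dilation of a family attaches to the added vertices in
a finite set. -/
noncomputable def dilateAdded (s : Finset (G.SingularVertex × ℕ)) : B :=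
  ∑ y ∈ s, M.single (some y) (some y) (F.remainder g y.1 (y.2 + 1))

/-- The projection that the dilation of a family attaches to a set of vertices. -/
noncomputable def dilateP (X : (G.desingularization g).GenSet) : B :=
  M.single none none (F.p X.base) + F.dilateAdded g M X.added

/-- The partial isometry that the dilation of a family attaches to an edge. -/
noncomputable def dilateS : (G.desingularization g).E → B
  | .inl e => M.single none none (F.s e.1)
  | .inr (.inl (v, n)) =>
    M.single (tailBlock v n) (tailBlock v (n + 1)) (F.remainder g v (n + 1))
  | .inr (.inr (v, n)) =>
    M.single (tailBlock (InfiniteEmitter.toSingular v) n) none (F.s (g v n).1)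

variable {g}

theorem dilateS_kept (e : G.KeptEdge) :
    F.dilateS g M (keptEdge g e) = M.single none none (F.s e.1) := rfl

theorem dilateS_tail (v : G.SingularVertex) (n : ℕ) :
    F.dilateS g M (tailEdge g v n) =
      M.single (tailBlock v n) (tailBlock v (n + 1)) (F.remainder g v (n + 1)) := rfl

theorem dilateS_emit (v : G.InfiniteEmitter) (n : ℕ) :
    F.dilateS g M (emitEdge g v n) =
      M.single (tailBlock v.toSingular n) none (F.s (g v n).1) := rfl

open Classical in
theorem dilateAdded_mul_dilateAdded (s t : Finset (G.SingularVertex × ℕ)) :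
    F.dilateAdded g M s * F.dilateAdded g M t = F.dilateAdded g M (s ∩ t) := by
  have hterm : ∀ y z : G.SingularVertex × ℕ,
      M.single (some y) (some y) (F.remainder g y.1 (y.2 + 1)) *
        M.single (some z) (some z) (F.remainder g z.1 (z.2 + 1)) =
      if y = z then M.single (some y) (some y) (F.remainder g y.1 (y.2 + 1)) else 0 := by
    intro y z
    split_ifs with h
    · rw [h, M.single_mul_single_same, remainder_mul_self]
    · exact M.single_mul_single_of_ne _ _ _ _ _ _ (mt (Option.some.inj ·) h)
  simp only [dilateAdded, Finset.sum_mul_sum, hterm, Finset.sum_ite_eq, Finset.sum_ite_mem]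

theorem single_none_mul_dilateAdded (a : A) (s : Finset (G.SingularVertex × ℕ)) :
    M.single none none a * F.dilateAdded g M s = 0 := by
  rw [dilateAdded, Finset.mul_sum]
  exact Finset.sum_eq_zero fun y _ => M.single_mul_single_of_ne _ _ _ _ _ _ nofun

theorem dilateAdded_mul_single_none (a : A) (s : Finset (G.SingularVertex × ℕ)) :
    F.dilateAdded g M s * M.single none none a = 0 := by
  rw [dilateAdded, Finset.sum_mul]
  exact Finset.sum_eq_zero fun y _ => M.single_mul_single_of_ne _ _ _ _ _ _ nofun

theorem dilateP_mul_dilateP (X Y : (G.desingularization g).GenSet) :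
    F.dilateP g M X * F.dilateP g M Y =
      F.dilateP g M ⟨X.set ∩ Y.set, X.isGenSet.inter Y.isGenSet⟩ := by
  classical
  rw [dilateP, dilateP, add_mul, mul_add, mul_add, single_none_mul_dilateAdded,
    dilateAdded_mul_single_none, add_zero, zero_add, M.single_mul_single_same,
    dilateAdded_mul_dilateAdded, F.p_inter, ← GenSet.added_inter]
  rfl

theorem isStarProjection_dilateP (X : (G.desingularization g).GenSet) :
    IsStarProjection (F.dilateP g M X) := by
  constructor
  · rw [IsIdempotentElem, dilateP_mul_dilateP]
    exact congrArg _ (GenSet.ext (Set.inter_self _))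
  · rw [IsSelfAdjoint, dilateP, dilateAdded, star_add, star_sum]
    simp only [M.star_single, star_p, star_remainder]

theorem dilateP_union (X Y : (G.desingularization g).GenSet) :
    F.dilateP g M ⟨X.set ∪ Y.set, X.isGenSet.union Y.isGenSet⟩ =
      F.dilateP g M X + F.dilateP g M Y -
        F.dilateP g M ⟨X.set ∩ Y.set, X.isGenSet.inter Y.isGenSet⟩ := by
  classical
  have hbase : F.p (GenSet.base ⟨X.set ∪ Y.set, X.isGenSet.union Y.isGenSet⟩) = F.p X.base +
      F.p Y.base - F.p (GenSet.base ⟨X.set ∩ Y.set, X.isGenSet.inter Y.isGenSet⟩) :=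
    F.p_union X.base Y.base
  have hadded : F.dilateAdded g M (X.added ∪ Y.added) =
      F.dilateAdded g M X.added + F.dilateAdded g M Y.added -
        F.dilateAdded g M (X.added ∩ Y.added) :=
    eq_sub_of_add_eq Finset.sum_union_inter
  rw [dilateP, dilateP, dilateP, dilateP, GenSet.added_union, GenSet.added_inter, hbase, hadded,
    map_sub, map_add]
  abel

theorem dilateP_toDesing (X : G.GenSet) :
    F.dilateP g M (X.toDesing g) = M.single none none (F.p X) := by
  rw [dilateP, GenSet.base_toDesing, GenSet.added_toDesing, dilateAdded, Finset.sum_empty,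
    add_zero]

theorem dilateP_empty : F.dilateP g M ⟨∅, .empty⟩ = 0 := by
  have h := F.dilateP_toDesing (g := g) M ⟨∅, .empty⟩
  rw [F.p_empty, map_zero] at h
  exact h ▸ congrArg _ (GenSet.ext (Set.image_empty _).symm)

theorem dilateP_vert_tailVert (v : G.SingularVertex) (n : ℕ) :
    F.dilateP g M ((G.desingularization g).vert (tailVert g v n)) =
      M.single (tailBlock v n) (tailBlock v n) (F.remainder g v n) := by
  cases n with
  | zero =>
    rw [show (G.desingularization g).vert (tailVert g v 0) = (G.vert v.1).toDesing g from
      (toDesing_vert v.1).symm, dilateP_toDesing, remainder_zero]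
    rfl
  | succ n =>
    change F.dilateP g M ((G.desingularization g).vert (addedVert g (v, n))) = _
    rw [dilateP, base_vert_addedVert, added_vert_addedVert, F.p_empty, map_zero, zero_add,
      dilateAdded, Finset.sum_singleton]
    rfl

theorem dilateP_mul_dilateS (e : (G.desingularization g).E) :
    F.dilateP g M ((G.desingularization g).vert ((G.desingularization g).s e)) *
      F.dilateS g M e = F.dilateS g M e := by
  induction e using edge_cases with
  | kept e =>
    rw [source_keptEdge, ← toDesing_vert, dilateP_toDesing, dilateS_kept,
      M.single_mul_single_same, F.p_vert_mul_s]
  | tail v n =>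
    rw [source_tailEdge, dilateP_vert_tailVert, dilateS_tail, M.single_mul_single_same,
      remainder_mul_remainder_succ]
  | emit v n =>
    rw [source_emitEdge, dilateP_vert_tailVert, dilateS_emit, M.single_mul_single_same,
      remainder_mul_s, if_neg n.lt_irrefl]

theorem star_dilateS_mul_self (e : (G.desingularization g).E) :
    star (F.dilateS g M e) * F.dilateS g M e =
      F.dilateP g M ((G.desingularization g).rng e) := by
  induction e using edge_cases with
  | kept e =>
    rw [dilateS_kept, M.star_single, M.single_mul_single_same, F.initial, rng_keptEdge,
      dilateP_toDesing]
  | tail v n =>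
    rw [dilateS_tail, M.star_single, M.single_mul_single_same, star_remainder,
      remainder_mul_self, rng_tailEdge, dilateP_vert_tailVert]
  | emit v n =>
    rw [dilateS_emit, M.star_single, M.single_mul_single_same, F.initial, rng_emitEdge,
      dilateP_toDesing]

theorem dilateS_mul_star_mul_self (e : (G.desingularization g).E) :
    F.dilateS g M e * star (F.dilateS g M e) * F.dilateS g M e = F.dilateS g M e := by
  induction e using edge_cases with
  | kept e =>
    rw [dilateS_kept, M.star_single, M.single_mul_single_same, M.single_mul_single_same,
      F.partialIsometry]
  | tail v n =>
    rw [dilateS_tail, M.star_single, M.single_mul_single_same, M.single_mul_single_same,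
      star_remainder, remainder_mul_self, remainder_mul_self]
  | emit v n =>
    rw [dilateS_emit, M.star_single, M.single_mul_single_same, M.single_mul_single_same,
      F.partialIsometry]

theorem star_dilateS_tail_mul_dilateS_emit (v : G.InfiniteEmitter) (n : ℕ) :
    star (F.dilateS g M (tailEdge g v.toSingular n)) * F.dilateS g M (emitEdge g v n) = 0 := by
  rw [dilateS_tail, dilateS_emit, M.star_single, M.single_mul_single_same, star_remainder,
    remainder_mul_s, if_pos n.lt_succ_self, map_zero]

theorem star_dilateS_mul_dilateS_of_source_eq {e f : (G.desingularization g).E} (hne : e ≠ f)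
    (hs : (G.desingularization g).s e = (G.desingularization g).s f) :
    star (F.dilateS g M e) * F.dilateS g M f = 0 := by
  induction e using edge_cases with
  | kept e =>
    obtain ⟨f, -, rfl⟩ := (source_eq_inclV_iff e.not_isSingular_source).1 hs.symm
    rw [dilateS_kept, dilateS_kept, M.star_single, M.single_mul_single_same,
      F.orthogonal_ranges _ _ fun h => hne (congrArg _ (Subtype.ext h)), map_zero]
  | tail v n =>
    obtain rfl | ⟨h, rfl⟩ := source_eq_tailVert_iff.1 hs.symm
    · exact absurd rfl hne
    · exact F.star_dilateS_tail_mul_dilateS_emit M ⟨v.1, h⟩ n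
  | emit v n =>
    obtain rfl | ⟨h, rfl⟩ := source_eq_tailVert_iff.1 (hs.symm.trans (source_emitEdge v n))
    · rw [← star_star (F.dilateS g M (tailEdge _ _ _)), ← star_mul,
        star_dilateS_tail_mul_dilateS_emit, star_zero]
    · exact absurd rfl hne

theorem star_dilateS_mul_dilateS {e f : (G.desingularization g).E} (hne : e ≠ f) :
    star (F.dilateS g M e) * F.dilateS g M f = 0 := by
  by_cases hs : (G.desingularization g).s e = (G.desingularization g).s f
  · exact F.star_dilateS_mul_dilateS_of_source_eq M hne hs
  · have hvert : F.dilateP g M ((G.desingularization g).vert ((G.desingularization g).s e)) *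
        F.dilateP g M ((G.desingularization g).vert ((G.desingularization g).s f)) = 0 := by
      rw [dilateP_mul_dilateP, ← F.dilateP_empty M]
      exact congrArg _ (GenSet.ext (Set.singleton_inter_eq_empty.2 hs))
    rw [← F.dilateP_mul_dilateS M e, ← F.dilateP_mul_dilateS M f, star_mul,
      (F.isStarProjection_dilateP M _).isSelfAdjoint.star_eq, mul_assoc,
      ← mul_assoc (F.dilateP g M _), hvert, zero_mul, mul_zero]

theorem dilateP_vert_tailVert_eq_sum (v : G.SingularVertex) (n : ℕ)
    (hfin : {e | (G.desingularization g).s e = tailVert g v n}.Finite) :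
    F.dilateP g M ((G.desingularization g).vert (tailVert g v n)) =
      ∑ e ∈ hfin.toFinset, F.dilateS g M e * star (F.dilateS g M e) := by
  rw [dilateP_vert_tailVert, sum_edges_tailVert, ← sub_add_cancel (F.remainder g v n),
    ← remainder_succ, map_add, dilateS_tail, M.star_single, M.single_mul_single_same,
    star_remainder, remainder_mul_self, listedProj]
  congr 1
  split_ifs with h
  · rw [dilateS_emit, M.star_single, M.single_mul_single_same]
    rfl
  · rw [map_zero]

theorem dilateP_vert_inclV_eq_sum {v : G.V} (hv : ¬ G.IsSingular v)
    (hfin : {e | (G.desingularization g).s e = G.inclV g v}.Finite) :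
    F.dilateP g M ((G.desingularization g).vert (G.inclV g v)) =
      ∑ e ∈ hfin.toFinset, F.dilateS g M e * star (F.dilateS g M e) := by
  have hfin' : {e | G.s e = v}.Finite := Set.not_infinite.1 fun h => hv (.inr h)
  have hne : {e | G.s e = v}.Nonempty := Set.nonempty_iff_ne_empty.2 fun h => hv (.inl h)
  rw [← toDesing_vert, dilateP_toDesing, F.regular_sum v hfin' hne, map_sum]
  refine (sum_edges_inclV hv hfin' hfin fun e => ?_).symm
  rw [dilateS_kept, M.star_single, M.single_mul_single_same]

variable (g) in
/-- A Cuntz–Krieger family of `G` dilates to one of the desingularization, which carries the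
remainder projection at `v_n` in a block of its own. -/
@[simps s]
noncomputable def dilate : (G.desingularization g).CKFamily B where
  s := F.dilateS g M
  p := F.dilateP g M
  partialIsometry := F.dilateS_mul_star_mul_self M
  orthogonal_ranges _ _ := F.star_dilateS_mul_dilateS M
  projection := F.isStarProjection_dilateP M
  p_empty := F.dilateP_empty M
  p_inter := F.dilateP_mul_dilateP M
  p_union := F.dilateP_union M
  initial := F.star_dilateS_mul_self M
  final_le e := by rw [← mul_assoc, dilateP_mul_dilateS]
  regular_sum x hfin _ := by
    induction x using vert_cases with
    | incl v =>
      by_cases hv : G.IsSingular v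
      · exact F.dilateP_vert_tailVert_eq_sum M ⟨v, hv⟩ 0 hfin
      · exact F.dilateP_vert_inclV_eq_sum M hv hfin
    | tail v n => exact F.dilateP_vert_tailVert_eq_sum M v (n + 1) hfin

theorem tailPath_dilate (v : G.SingularVertex) (n : ℕ) :
    (F.dilate g M).tailPath v n = M.single none (tailBlock v n) (F.remainder g v n) := by
  induction n with
  | zero => exact F.dilateP_vert_tailVert M v 0
  | succ n ih =>
    rw [tailPath_succ, ih, dilate_s, dilateS_tail, M.single_mul_single_same,
      remainder_mul_remainder_succ]

theorem restrictS_dilate (e : G.E) :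
    (F.dilate g M).restrictS e = M.single none none (F.s e) := by
  induction e using edge_kept_or_listed g with
  | kept e => exact (F.dilate g M).restrictS_kept e
  | listed v n =>
    rw [restrictS_listed, exitPath, tailPath_dilate, dilate_s, dilateS_emit,
      M.single_mul_single_same, remainder_mul_s, if_neg n.lt_irrefl]

end Dilation

end CKFamily

theorem CStar.lift_restrict_injective {G : Ultragraph.{u}} (g : G.EmitterListing) :
    Function.Injective (CStar.lift (G.desingularization g).gen.restrict) := by
  intro a b hab
  refine CStar.ext_rep fun ω => ?_
  let M := hilbertMatrixSystem (Option (G.SingularVertex × ℕ)) ω.H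
  let ω' : (G.desingularization g).HilbertFamily := ⟨_, ω.fam.dilate g M⟩
  have hcomp : ((G.desingularization g).rep ω').comp (lift (G.desingularization g).gen.restrict) =
      (M.diag none).comp (G.rep ω) :=
    hom_ext
      (fun e => ((G.desingularization g).gen.restrictS_map (rep _ ω') e).symm.trans
        (ω.fam.restrictS_dilate M e))
      (ω.fam.dilateP_toDesing M)
  have h := DFunLike.congr_fun hcomp
  apply hilbertMatrixSystem_diag_injective none
  exact (h a).symm.trans ((congrArg (rep _ ω') hab).trans (h b))

/-! ### Compressions of the generators -/

section Compression

variable {A : Type*} [NonUnitalRing A] [StarRing A] [Module ℂ A]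

/-- The columns indexed by `C` with entries in `S`: the elements that every element of `C`
multiplies into `S`. -/
def columnSpace [SMulCommClass ℂ A A] (S : NonUnitalStarSubalgebra ℂ A) (C : Set A) :
    Submodule ℂ A where
  carrier := {x | ∀ c ∈ C, c * x ∈ S}
  add_mem' hx hy c hc := by
    rw [mul_add]
    exact add_mem (hx c hc) (hy c hc)
  zero_mem' c _ := by
    rw [mul_zero]
    exact zero_mem S
  smul_mem' z x hx c hc := by
    rw [mul_smul_comm]
    exact SMulMemClass.smul_mem z (hx c hc)

/-- The elements that, together with their adjoints, multiply a subspace into itself. -/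
def multiplierSubalgebra [IsScalarTower ℂ A A] [StarModule ℂ A] (W : Submodule ℂ A) :
    NonUnitalStarSubalgebra ℂ A where
  carrier := {a | ∀ x ∈ W, a * x ∈ W ∧ star a * x ∈ W}
  add_mem' ha hb x hx := by
    rw [star_add, add_mul, add_mul]
    exact ⟨W.add_mem (ha x hx).1 (hb x hx).1, W.add_mem (ha x hx).2 (hb x hx).2⟩
  zero_mem' x _ := by
    rw [star_zero, zero_mul]
    exact ⟨W.zero_mem, W.zero_mem⟩
  mul_mem' ha hb x hx := by
    rw [star_mul, mul_assoc, mul_assoc]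
    exact ⟨(ha _ (hb x hx).1).1, (hb _ (ha x hx).2).2⟩
  smul_mem' z a ha x hx := by
    rw [star_smul, smul_mul_assoc, smul_mul_assoc]
    exact ⟨W.smul_mem _ (ha x hx).1, W.smul_mem _ (ha x hx).2⟩
  star_mem' ha x hx := by
    rw [star_star]
    exact (ha x hx).symm

theorem isClosed_multiplierSubalgebra [IsScalarTower ℂ A A] [StarModule ℂ A] [TopologicalSpace A]
    [ContinuousMul A] [ContinuousStar A] {W : Submodule ℂ A} (hW : IsClosed (W : Set A)) :
    IsClosed (multiplierSubalgebra W : Set A) := by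
  have : (multiplierSubalgebra W : Set A) =
      ⋂ x ∈ W, (· * x) ⁻¹' (W : Set A) ∩ (star · * x) ⁻¹' (W : Set A) := by
    ext a
    simp only [Set.mem_iInter]
    rfl
  rw [this]
  exact isClosed_biInter fun x _ => (hW.preimage (continuous_mul_const x)).inter
    (hW.preimage (continuous_star.mul_const x))

variable [SMulCommClass ℂ A A] {S : NonUnitalStarSubalgebra ℂ A} {C : Set A}

theorem isClosed_columnSpace [TopologicalSpace A] [ContinuousMul A]
    (hS : IsClosed (S : Set A)) : IsClosed (columnSpace S C : Set A) := by
  have : (columnSpace S C : Set A) = ⋂ c ∈ C, (c * ·) ⁻¹' (S : Set A) := by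
    ext x
    simp only [Set.mem_iInter]
    rfl
  rw [this]
  exact isClosed_biInter fun c _ => hS.preimage (continuous_const_mul c)

variable [IsScalarTower ℂ A A] [StarModule ℂ A]

theorem star_mul_mul_mem_multiplierSubalgebra (hC : ∀ c ∈ C, ∀ d ∈ C, c * star d ∈ S) {c d t : A}
    (hc : c ∈ C) (ht : t ∈ S) (hd : d ∈ C) :
    star c * t * d ∈ multiplierSubalgebra (columnSpace S C) := by
  have hmem : ∀ c ∈ C, ∀ t ∈ S, ∀ d ∈ C, ∀ x ∈ columnSpace S C,
      star c * t * d * x ∈ columnSpace S C := by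
    intro c hc t ht d hd x hx b hb
    rw [show b * (star c * t * d * x) = b * star c * t * (d * x) by simp only [mul_assoc]]
    exact mul_mem (mul_mem (hC b hb c hc) ht) (hx d hd)
  refine fun x hx => ⟨hmem c hc t ht d hd x hx, ?_⟩
  rw [star_mul, star_mul, star_star, ← mul_assoc]
  exact hmem d hd _ (star_mem ht) c hc x hx

theorem mul_mul_star_mem_of_mem_multiplierSubalgebra (hC : ∀ c ∈ C, ∀ d ∈ C, c * star d ∈ S)
    {a c d : A} (ha : a ∈ multiplierSubalgebra (columnSpace S C)) (hc : c ∈ C) (hd : d ∈ C) :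
    c * a * star d ∈ S := by
  rw [mul_assoc]
  exact (ha (star d) fun b hb => hC b hb d hd).1 c hc

end Compression

namespace CKFamily

theorem remainder_mem {G : Ultragraph.{u}} {A : Type*} [NonUnitalRing A] [StarRing A]
    [Module ℂ A] (F : G.CKFamily A) (g : G.EmitterListing) {S : NonUnitalStarSubalgebra ℂ A}
    (hs : ∀ e, F.s e ∈ S) (hp : ∀ X, F.p X ∈ S) (v : G.SingularVertex) (n : ℕ) :
    F.remainder g v n ∈ S := by
  refine sub_mem (hp _) (sum_mem fun j _ => ?_)
  unfold listedProj
  split_ifs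
  exacts [mul_mem (hs _) (star_mem (hs _)), zero_mem S]

variable {G : Ultragraph.{u}} {g : G.EmitterListing} {A : Type*} [NonUnitalRing A] [StarRing A]
  (F : (G.desingularization g).CKFamily A)

/-- The elements that connect the vertices of the desingularization to those of `G`: the
projections at sets of vertices of `G`, and the tail paths. -/
def connectors : Set A :=
  Set.range F.restrict.p ∪ Set.range fun y : G.SingularVertex × ℕ => F.tailPath y.1 (y.2 + 1)

theorem p_toDesing_mem_connectors (X : G.GenSet) : F.p (X.toDesing g) ∈ F.connectors :=
  .inl ⟨X, rfl⟩

theorem tailPath_mem_connectors (v : G.SingularVertex) : ∀ n, F.tailPath v n ∈ F.connectors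
  | 0 => .inl ⟨G.vert v.1, congrArg F.p (toDesing_vert v.1)⟩
  | n + 1 => .inr ⟨(v, n), rfl⟩

theorem tailPath_mul_p_toDesing (v : G.SingularVertex) (n : ℕ) (X : G.GenSet) :
    F.tailPath v (n + 1) * F.p (X.toDesing g) = 0 := by
  rw [← tailPath_mul_p, mul_assoc, F.p_mul_of_disjoint (disjoint_toDesing_tailVert X v n).symm,
    mul_zero]

theorem tailPath_mul_star_tailPath_of_ne {v v' : G.SingularVertex} {n n' : ℕ}
    (h : tailVert g v n ≠ tailVert g v' n') :
    F.tailPath v n * star (F.tailPath v' n') = 0 := by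
  rw [← tailPath_mul_p, ← F.tailPath_mul_p v', star_mul, F.star_p, mul_assoc, ← mul_assoc (F.p _),
    F.p_mul_of_disjoint (Set.disjoint_singleton.2 h), zero_mul, mul_zero]

variable [Module ℂ A] {S : NonUnitalStarSubalgebra ℂ A} (hs : ∀ e, F.restrict.s e ∈ S)
  (hp : ∀ X, F.restrict.p X ∈ S)
include hs hp

theorem mul_star_mem_of_mem_connectors :
    ∀ c ∈ F.connectors, ∀ d ∈ F.connectors, c * star d ∈ S := by
  rintro _ (⟨X, rfl⟩ | ⟨⟨v, n⟩, rfl⟩) _ (⟨Y, rfl⟩ | ⟨⟨v', n'⟩, rfl⟩)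
  · exact mul_mem (hp X) (star_mem (hp Y))
  · have h := congrArg star (F.tailPath_mul_p_toDesing v' n' X)
    rw [star_mul, F.star_p, star_zero] at h
    exact h ▸ zero_mem S
  · rw [F.restrict.star_p]
    exact F.tailPath_mul_p_toDesing v n Y ▸ zero_mem S
  · by_cases h : tailVert g v (n + 1) = tailVert g v' (n' + 1)
    · obtain ⟨rfl, hn⟩ := tailVert_inj.1 h
      obtain rfl := Nat.succ_injective hn
      exact F.tailPath_mul_star_self v (n + 1) ▸ F.restrict.remainder_mem g hs hp v (n + 1)
    · exact F.tailPath_mul_star_tailPath_of_ne h ▸ zero_mem S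

variable [SMulCommClass ℂ A A] [IsScalarTower ℂ A A] [StarModule ℂ A]

theorem p_mem_multiplierSubalgebra (X : (G.desingularization g).GenSet) :
    F.p X ∈ multiplierSubalgebra (columnSpace S F.connectors) := by
  have hC := F.mul_star_mem_of_mem_connectors hs hp
  induction X using GenSet.desingularization_induction with
  | toDesing X =>
    have hX := F.p_toDesing_mem_connectors X
    have h := star_mul_mul_mem_multiplierSubalgebra hC hX (hp X) hX
    rwa [F.star_p, show F.restrict.p X = F.p (X.toDesing g) from rfl, F.p_mul_self,
      F.p_mul_self] at h
  | added y =>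
    have hT := F.tailPath_mem_connectors y.1 (y.2 + 1)
    have h := star_mul_mul_mem_multiplierSubalgebra hC hT (hC _ hT _ hT) hT
    rwa [← mul_assoc, star_tailPath_mul_self, mul_assoc, star_tailPath_mul_self,
      F.p_mul_self] at h
  | inter X Y hX hY => exact F.p_inter X Y ▸ mul_mem hX hY
  | union X Y hX hY =>
    rw [F.p_union, ← F.p_inter]
    exact sub_mem (add_mem hX hY) (mul_mem hX hY)

theorem s_mem_multiplierSubalgebra (e : (G.desingularization g).E) :
    F.s e ∈ multiplierSubalgebra (columnSpace S F.connectors) := by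
  have hC := F.mul_star_mem_of_mem_connectors hs hp
  induction e using edge_cases with
  | kept e =>
    have h := star_mul_mul_mem_multiplierSubalgebra hC
      (F.p_toDesing_mem_connectors (G.vert (G.s e.1))) (hs e.1)
      (F.p_toDesing_mem_connectors (G.rng e.1))
    rwa [F.star_p, toDesing_vert, show F.restrict.s e.1 = F.s (keptEdge g e) from
      F.restrictS_kept e, ← source_keptEdge, F.p_vert_mul_s, ← rng_keptEdge, F.s_mul_p_rng] at h
  | tail v n =>
    have hT := F.tailPath_mem_connectors v
    have h := star_mul_mul_mem_multiplierSubalgebra hC (hT n)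
      (hC _ (hT (n + 1)) _ (hT (n + 1))) (hT (n + 1))
    rwa [mul_assoc, mul_assoc (F.tailPath v (n + 1)), star_tailPath_mul_self, tailPath_mul_p,
      tailPath_succ, ← mul_assoc, star_tailPath_mul_self, ← source_tailEdge, F.p_vert_mul_s] at h
  | emit v n =>
    have h := star_mul_mul_mem_multiplierSubalgebra hC
      (F.tailPath_mem_connectors v.toSingular n) (hs (g v n).1)
      (F.p_toDesing_mem_connectors (G.rng (g v n).1))
    rwa [show F.restrict.s (g v n).1 = F.exitPath v n from F.restrictS_listed v n,
      star_tailPath_mul_exitPath, ← rng_emitEdge, F.s_mul_p_rng] at h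

end CKFamily

/-! ### The isomorphism onto the corner -/

section Corner

variable {G : Ultragraph.{u}} {g : G.EmitterListing}

theorem CStar.p_mul_mul_p_mem {S : NonUnitalStarSubalgebra ℂ (G.desingularization g).CStar}
    (hclosed : IsClosed (S : Set (G.desingularization g).CStar))
    (hs : ∀ e, (G.desingularization g).gen.restrict.s e ∈ S)
    (hp : ∀ X, (G.desingularization g).gen.restrict.p X ∈ S) (X Y : G.GenSet)
    (a : (G.desingularization g).CStar) :
    (G.desingularization g).gen.p (X.toDesing g) * a *
      (G.desingularization g).gen.p (Y.toDesing g) ∈ S := by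
  set q := (G.desingularization g).gen
  have htop := (G.desingularization g).eq_top_of_gen_mem _
    (isClosed_multiplierSubalgebra (isClosed_columnSpace hclosed))
    (q.s_mem_multiplierSubalgebra hs hp) (q.p_mem_multiplierSubalgebra hs hp)
  have h := mul_mul_star_mem_of_mem_multiplierSubalgebra (a := a)
    (q.mul_star_mem_of_mem_connectors hs hp) (htop ▸ trivial)
    (q.p_toDesing_mem_connectors X) (q.p_toDesing_mem_connectors Y)
  rwa [q.star_p] at h

open scoped CStarAlgebra in
theorem CStar.isClosed_range_lift_restrict (g : G.EmitterListing) :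
    IsClosed (Set.range (lift (G.desingularization g).gen.restrict)) :=
  (NonUnitalStarAlgHom.isometry _ (lift_restrict_injective g)).isClosedEmbedding.isClosed_range

variable {Y : ℕ → G.GenSet} {p : 𝓜(ℂ, (G.desingularization g).CStar)} {hp : IsStarProjection p}

theorem IsExhaustion.lift_restrict_mem_corner (hY : IsExhaustion Y)
    (hlim : StrictlyTendsto (limitingProj g Y) p) (a : G.CStar) :
    CStar.lift (G.desingularization g).gen.restrict a ∈ corner p hp := by
  have hcorner : ∀ X, (G.desingularization g).gen.restrict.p X ∈ corner p hp :=
    hY.p_toDesing_mem_corner hlim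
  refine CStar.map_mem_of_gen_mem _ (isClosed_corner hp) (fun e => ?_) hcorner a
  set F := (G.desingularization g).gen.restrict
  rw [CStar.lift_s, ← F.p_vert_mul_s, ← F.s_mul_p_rng, ← mul_assoc]
  exact mul_mul_mem_corner hp (hcorner _) _ (hcorner _)

theorem CStar.mem_range_lift_restrict_of_mem_corner
    (hlim : StrictlyTendsto (limitingProj g Y) p)
    {x : (G.desingularization g).CStar} (hx : x ∈ corner p hp) :
    x ∈ Set.range (CStar.lift (G.desingularization g).gen.restrict) := by
  have hclosed := CStar.isClosed_range_lift_restrict g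
  have htend := hlim.tendsto_fst_snd x
  rw [((mem_corner_iff hp).1 hx).2, ((mem_corner_iff hp).1 hx).1] at htend
  refine hclosed.mem_of_tendsto htend (.of_forall fun n => ?_)
  have := CStar.p_mul_mul_p_mem
    (S := NonUnitalStarAlgHom.range (CStar.lift (G.desingularization g).gen.restrict)) hclosed
    (fun e => ⟨G.gen.s e, rfl⟩) (fun X => ⟨G.gen.p X, rfl⟩) (Y n) (Y n) x
  rwa [mul_assoc] at this

/-- The isomorphism of `C*(G)` onto the corner of a desingularization. -/
noncomputable def IsExhaustion.cornerEquiv (hY : IsExhaustion Y)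
    (hlim : StrictlyTendsto (limitingProj g Y) p) : G.CStar ≃⋆ₐ[ℂ] corner p hp :=
  StarAlgEquiv.ofBijective
    (NonUnitalStarAlgHom.codRestrict (CStar.lift (G.desingularization g).gen.restrict)
      (corner p hp) (hY.lift_restrict_mem_corner hlim))
    ⟨fun _ _ h => CStar.lift_restrict_injective g (congrArg Subtype.val h), fun x =>
      (CStar.mem_range_lift_restrict_of_mem_corner hlim x.2).imp fun _ h => Subtype.ext h⟩

end Corner

end Ultragraph

theorem proposition6p7 (G : Ultragraph.{u}) (g : G.EmitterListing)
    (w : ℕ → Option G.V) (hw : ∀ v, ∃ i, w i = some v)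
    (h : ℕ → Option G.E) (hh : ∀ e, ∃ i, h i = some e) :
    ∃ (p : 𝓜(ℂ, (G.desingularization g).CStar)) (hp : IsStarProjection p),
      Ultragraph.StrictlyTendsto
        (fun n => (((G.desingularization g).gen.p ((G.initialGenSet w h n).toDesing g) :
          (G.desingularization g).CStar) : 𝓜(ℂ, (G.desingularization g).CStar))) p ∧
      Ultragraph.IsFullCorner p hp ∧
      Nonempty (G.CStar ≃⋆ₐ[ℂ] Ultragraph.corner p hp) := by
  have hY : Ultragraph.IsExhaustion (G.initialGenSet w h) :=
    Ultragraph.isExhaustion_initialGenSet hw hh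
  obtain ⟨p, hlim⟩ := hY.exists_strictlyTendsto (g := g)
  have hp : IsStarProjection p :=
    hlim.isStarProjection Ultragraph.isStarProjection_limitingProj
  exact ⟨p, hp, hlim, hY.isFullCorner hlim, ⟨hY.cornerEquiv hlim⟩⟩
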